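/- Let $k \ge 2$ be an integer and let $\alpha, \beta > 0$ be real constants. For $n$ even, let $$p = \frac{\alpha \log n}{\binom{n-1}{k-1}}, \qquad q = \frac{\beta \log n}{\binom{n-1}{k-1}}$$ (both lie in $[0,1]$ for $n$ large), and let $(\sigma, \mathcal{H})$ be drawn from the $k$-uniform hypergraph stochastic block model $\mathsf{HSBM}(n,p,q;k)$: $\sigma \in \{\pm 1\}^{[n]}$ is uniform among the vectors with equally many entries $+1$ and $-1$ (the balanced vectors), and, given $\sigma$, each $k$-element subset $e$ of $[n]$ is a hyperedge of $\mathcal{H}$ independently, with probability $p$ if $\sigma$ is constant on $e$ and with probability $q$ otherwise. An estimator $\widehat\sigma$ assigns a vector $\widehat\sigma(H) \in \{\pm 1\}^{[n]}$ to each $k$-uniform hypergraph $H$ on $[n]$. A maximum-likelihood estimator is one for which $\widehat\sigma(H)$ is, for each $H$, a maximizer of $x \mapsto \Pr(\mathcal{H} = H \mid \sigma = x)$ over the balanced $x \in \{\pm 1\}^{[n]}$, with ties broken arbitrarily. Put $$I(\alpha,\beta) = \frac{(\sqrt{\alpha} - \sqrt{\beta})^2}{2^{k-1}}.$$ In the following,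 $n \to \infty$ along the even numbers. (i) If $I(\alpha,\beta) > 1$, then exact recovery is possible: there is an estimator $\widehat\sigma$ with $\Pr(\widehat\sigma(\mathcal{H}) \notin \{\sigma, -\sigma\}) = o(1)$. In fact, every maximum-likelihood estimator satisfies $$\Pr(\widehat\sigma(\mathcal{H}) \notin \{\sigma, -\sigma\}) \le n^{-\frac{I(\alpha,\beta) - 1}{2} + o(1)}.$$ (ii) If $I(\alpha,\beta) < 1$, then exact recovery is impossible: every estimator $\widehat\sigma$ satisfies $\Pr(\widehat\sigma(\mathcal{H}) \notin \{\sigma, -\sigma\}) = 1 - o(1)$. -/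

import Mathlib

open Filter Topology

noncomputable section

namespace HSBM

/-- Vectors in `{±1}^V` with `V = [n]`: community labels of the vertices. -/
abbrev Labeling (n : ℕ) : Type := Fin n → ℤˣ

/-- The labels `+1` and `-1` are used equally often. -/
def Balanced {n : ℕ} (σ : Labeling n) : Prop := ∑ v, (σ v : ℤ) = 0

/-- The collection of the subsets of size `k` of the vertex set `[n]`. -/
abbrev KSubset (n k : ℕ) : Type := {e : Finset (Fin n) // e.card = k}

/-- A `k`-uniform hypergraph on the vertex set `[n]`, given by its set of hyperedges. -/
abbrev Hypergraph (n k : ℕ) : Type := Finset (KSubset n k)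

/-- `e` is in-cluster with respect to `σ`: all its vertices carry the same label. -/
def InCluster {n k : ℕ} (σ : Labeling n) (e : KSubset n k) : Prop :=
  ∀ u ∈ e.1, ∀ v ∈ e.1, σ u = σ v

open scoped Classical in
/-- The probability that `e` is a hyperedge, given the labels `σ`. -/
def edgeProb {n k : ℕ} (p q : ℝ) (σ : Labeling n) (e : KSubset n k) : ℝ :=
  if InCluster σ e then p else q

open scoped Classical in
/-- The conditional probability of the hypergraph `H` given the labels `σ`, when each set of size
`k` is a hyperedge independently of the others. -/
def likelihood {n k : ℕ} (p q : ℝ) (σ : Labeling n) (H : Hypergraph n k) : ℝ :=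
  ∏ e : KSubset n k, if e ∈ H then edgeProb p q σ e else 1 - edgeProb p q σ e

open scoped Classical in
/-- The finite set of balanced labelings. -/
def balanced (n : ℕ) : Finset (Labeling n) := Finset.univ.filter Balanced

open scoped Classical in
/-- The probability of the event `E` when `(σ, H)` is drawn from `HSBM(n, p, q; k)`: `σ` is uniform
among the balanced labelings and, given `σ`, the hypergraph `H` has the law `likelihood p q σ`.
(This is a probability law for `n` even and `p, q` in `[0, 1]`.) -/
def prob (n k : ℕ) (p q : ℝ) (E : Labeling n → Hypergraph n k → Prop) : ℝ :=
  ∑ σ ∈ balanced n, (1 / ((balanced n).card : ℝ)) *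
    ∑ H : Hypergraph n k, if E σ H then likelihood p q σ H else 0

/-- An estimator: it sees the hypergraph and returns a vector of labels. -/
abbrev Estimator (n k : ℕ) : Type := Hypergraph n k → Labeling n

/-- The probability that the estimator fails to recover the labels up to a global sign flip. -/
def failProb {n k : ℕ} (p q : ℝ) (τ : Estimator n k) : ℝ :=
  prob n k p q fun σ H => ¬ (τ H = σ ∨ τ H = -σ)

/-- `τ` is a maximum-likelihood estimator: for each `H` it returns a maximizer of the likelihood
over the balanced labelings (ties may be broken in any way). -/
def IsMLE {n k : ℕ} (p q : ℝ) (τ : Estimator n k) : Prop :=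
  ∀ H : Hypergraph n k, Balanced (τ H) ∧
    ∀ x : Labeling n, Balanced x → likelihood p q x H ≤ likelihood p q (τ H) H

/-- `n → ∞` along the even numbers. -/
def evenAtTop : Filter ℕ := atTop ⊓ 𝓟 {n : ℕ | Even n}

/-- Exact recovery is possible: some (sequence of) estimators fails with probability `o(1)`. -/
def ExactRecoveryPossible (k : ℕ) (p q : ℕ → ℝ) : Prop :=
  ∃ τ : ∀ n : ℕ, Estimator n k, Tendsto (fun n => failProb (p n) (q n) (τ n)) evenAtTop (𝓝 0)

/-- Exact recovery is impossible: all estimators fail with probability `1 - o(1)`. -/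
def ExactRecoveryImpossible (k : ℕ) (p q : ℕ → ℝ) : Prop :=
  ∀ τ : ∀ n : ℕ, Estimator n k, Tendsto (fun n => failProb (p n) (q n) (τ n)) evenAtTop (𝓝 1)

/-- The edge probability `a log n / C(n-1, k-1)`. -/
def rate (k : ℕ) (a : ℝ) (n : ℕ) : ℝ := a * Real.log n / ((n - 1).choose (k - 1) : ℝ)

/-- `I(α, β) = (√α - √β)² / 2^(k-1)`. -/
def threshold (k : ℕ) (α β : ℝ) : ℝ := (Real.sqrt α - Real.sqrt β) ^ 2 / 2 ^ (k - 1)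

end HSBM

end

/-!
For a given hypergraph, the likelihood of a balanced labeling depends only on the number of its
in-cluster hyperedges. The law of the hypergraph is that of a random subset of the `k`-sets with
independent elements, and expectations are finite sums (`bernWeight`, `expect`).

*Above the threshold.* If a maximum-likelihood estimator errs, it prefers to the truth `σ` a
balanced labeling `x` that, up to a global sign, differs from `σ` on a set `S` with `1 ≤ |S| ≤ n /
2`. For fixed `x` this has probability at most the Bhattacharyya coefficient of the two product
laws, and it tensorizes over the `k`-sets (`sum_sqrt_likelihood_mul_le`). The sets with one vertex
in `S` and the others in one half outside `S` have different status for `σ` and `x`, so the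
coefficient is at most `exp (-|S| * C(n/2 - |S|/2, k-1) * (√p - √q)²)` (`exists_changed`,
`failProb_le_of_isMLE`). For small `|S|` this is about `n ^ (-I |S|)`, and `∑ z ^ |S| = (1 + z) ^
n` sums it; sets `S` of linear size contribute `2 ^ n * n ^ (-c n)` (`exp_neg_mul_choose_le`,
`eventually_sum_le_rpow`). The total is below `n ^ (-(I - 1) / 2)`, so that no `o(1)` correction
in the exponent is needed.

*Below the threshold.* If `K` balanced labelings have the same likelihood as the truth, no
estimator can tell them apart, and it succeeds with probability at most `2 / K`
(`one_sub_le_failProb`). Such labelings arise by exchanging the labels of two vertices of opposite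
clusters, each of which has as many hyperedges into its own cluster as into the other
(`likelihood_swapLabels`). To find them, reserve about `n ^ (1 - γ)` vertices of each cluster,
with `γ = (1 - I) / 2`, and count for each reserved vertex only the hyperedges whose other
vertices are not reserved. For different vertices these counts are independent, and a tie has
probability `n ^ (-I)` up to logarithms: it is the product of a squared Bhattacharyya coefficient
and the probability that two independent equally distributed binomial variables coincide
(`le_sum_sq_binomial`, `le_tieProb`). Chebyshev's inequality yields many ties. The event that a
hyperedge contains a further reserved vertex is independent of a tie and has small probability, so
Markov's inequality removes the ties that it spoils (`expect_sum_lt_le`,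
`sum_likelihood_few_ties_le`).
-/

namespace HSBM

/-! ### Random subsets with independent elements -/

section RandomSubset

variable {ι : Type*} [DecidableEq ι]

/-- The probability that the trace on `A` of a random set, which contains each `e` independently
with probability `r e`, equals `H ∩ A`. -/
noncomputable def bernWeight (r : ι → ℝ) (A H : Finset ι) : ℝ :=
  ∏ e ∈ A, if e ∈ H then r e else 1 - r e

theorem bernWeight_nonneg {r : ι → ℝ} (h0 : ∀ e, 0 ≤ r e) (h1 : ∀ e, r e ≤ 1) (A H : Finset ι) :
    0 ≤ bernWeight r A H := by
  refine Finset.prod_nonneg fun e _ => ?_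
  split_ifs
  · exact h0 e
  · linarith [h1 e]

theorem bernWeight_of_subset {r : ι → ℝ} {A H : Finset ι} (h : H ⊆ A) :
    bernWeight r A H = (∏ e ∈ H, r e) * ∏ e ∈ A \ H, (1 - r e) := by
  unfold bernWeight
  rw [← Finset.prod_sdiff h, mul_comm]
  congr 1
  · exact Finset.prod_congr rfl fun e he => if_pos he
  · exact Finset.prod_congr rfl fun e he => if_neg (Finset.mem_sdiff.1 he).2

theorem sum_bernWeight (r : ι → ℝ) (A : Finset ι) : ∑ H ∈ A.powerset, bernWeight r A H = 1 := by
  rw [Finset.sum_congr rfl fun H hH => bernWeight_of_subset (Finset.mem_powerset.1 hH),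
    ← Finset.prod_add]
  simp

theorem bernWeight_union {r : ι → ℝ} {A B S T : Finset ι} (hAB : Disjoint A B) (hS : S ⊆ A)
    (hT : T ⊆ B) : bernWeight r (A ∪ B) (S ∪ T) = bernWeight r A S * bernWeight r B T := by
  unfold bernWeight
  rw [Finset.prod_union hAB]
  congr 1
  · refine Finset.prod_congr rfl fun e he => ?_
    have : e ∉ T := fun h => Finset.disjoint_left.1 hAB he (hT h)
    simp [this]
  · refine Finset.prod_congr rfl fun e he => ?_
    have : e ∉ S := fun h => Finset.disjoint_left.1 hAB (hS h) he
    simp [this]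

/-- The law of the cardinality of a random subset is binomial. -/
theorem sum_bernWeight_card {r : ι → ℝ} {A : Finset ι} {p : ℝ} (h : ∀ e ∈ A, r e = p) (j : ℕ) :
    ∑ H ∈ A.powerset, bernWeight r A H * (if H.card = j then 1 else 0) =
      (A.card.choose j : ℝ) * (p ^ j * (1 - p) ^ (A.card - j)) := by
  simp only [mul_ite, mul_one, mul_zero]
  rw [← Finset.sum_filter, ← Finset.powersetCard_eq_filter, ← Finset.card_powersetCard j A,
    ← nsmul_eq_mul]
  refine Finset.sum_eq_card_nsmul fun H hH => ?_
  obtain ⟨hs, hc⟩ := Finset.mem_powersetCard.1 hH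
  rw [bernWeight_of_subset hs, Finset.prod_congr rfl fun e he => h e (hs he),
    Finset.prod_congr (s₁ := A \ H) rfl fun e he => by rw [h e (Finset.mem_sdiff.1 he).1]]
  simp [Finset.card_sdiff_of_subset hs, hc]

variable [Fintype ι]

/-- The expectation of `F` at a random set that contains each `e` independently with probability
`r e`. -/
noncomputable def expect (r : ι → ℝ) (F : Finset ι → ℝ) : ℝ :=
  ∑ H, bernWeight r Finset.univ H * F H

theorem expect_one (r : ι → ℝ) : expect r (fun _ => 1) = 1 := by
  simpa [expect] using sum_bernWeight r Finset.univ

theorem expect_mono {r : ι → ℝ} (h0 : ∀ e, 0 ≤ r e) (h1 : ∀ e, r e ≤ 1) {F G : Finset ι → ℝ}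
    (h : ∀ H, F H ≤ G H) : expect r F ≤ expect r G :=
  Finset.sum_le_sum fun H _ => mul_le_mul_of_nonneg_left (h H) (bernWeight_nonneg h0 h1 _ _)

theorem expect_sum {κ : Type*} (r : ι → ℝ) (s : Finset κ) (F : κ → Finset ι → ℝ) :
    expect r (fun H => ∑ i ∈ s, F i H) = ∑ i ∈ s, expect r (F i) := by
  unfold expect
  rw [Finset.sum_comm]
  exact Finset.sum_congr rfl fun H _ => by rw [Finset.mul_sum]

theorem expect_add (r : ι → ℝ) (F G : Finset ι → ℝ) :
    expect r (fun H => F H + G H) = expect r F + expect r G := by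
  unfold expect
  rw [← Finset.sum_add_distrib]
  exact Finset.sum_congr rfl fun H _ => by ring

theorem expect_const_mul (r : ι → ℝ) (c : ℝ) (F : Finset ι → ℝ) :
    expect r (fun H => c * F H) = c * expect r F := by
  unfold expect
  rw [Finset.mul_sum]
  exact Finset.sum_congr rfl fun H _ => by ring

/-- Fubini: a set is the union of its traces on `A` and on `Aᶜ`, and the weights multiply. -/
theorem expect_inter_mul_sdiff (r : ι → ℝ) (A : Finset ι) (F G : Finset ι → ℝ) :
    expect r (fun H => F (H ∩ A) * G (H \ A)) =
      (∑ S ∈ A.powerset, bernWeight r A S * F S) *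
        ∑ T ∈ Aᶜ.powerset, bernWeight r Aᶜ T * G T := by
  unfold expect
  rw [Finset.sum_mul_sum, ← Finset.sum_product']
  refine Finset.sum_nbij' (fun H => (H ∩ A, H \ A)) (fun P => P.1 ∪ P.2) ?_ ?_ ?_ ?_ ?_
  · intro H _
    simp only [Finset.mem_product, Finset.mem_powerset]
    exact ⟨Finset.inter_subset_right, fun e he => by simp at he ⊢; exact he.2⟩
  · simp
  · intro H _
    ext e; simp; tauto
  · rintro ⟨S, T⟩ h
    simp only [Finset.mem_product, Finset.mem_powerset] at h
    have hT : ∀ e ∈ T, e ∉ A := fun e he => by simpa using h.2 he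
    have hS : ∀ e ∈ S, e ∈ A := fun e he => h.1 he
    ext e
    · simp only [Finset.mem_inter, Finset.mem_union]
      grind
    · simp only [Finset.mem_sdiff, Finset.mem_union]
      grind
  · intro H _
    have h1 : H ∩ A ⊆ A := Finset.inter_subset_right
    have h2 : H \ A ⊆ Aᶜ := fun e he => by simp at he ⊢; exact he.2
    have := bernWeight_union (r := r) (disjoint_compl_right (a := A)) h1 h2
    rw [show (H ∩ A) ∪ (H \ A) = H by ext e; simp; tauto,
      Finset.union_compl] at this
    simp only
    rw [this]
    ring

theorem expect_inter (r : ι → ℝ) (A : Finset ι) (F : Finset ι → ℝ) :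
    expect r (fun H => F (H ∩ A)) = ∑ S ∈ A.powerset, bernWeight r A S * F S := by
  have := expect_inter_mul_sdiff r A F (fun _ => 1)
  simpa [sum_bernWeight] using this

/-- Independence: functions of the traces of the random set on disjoint sets are uncorrelated. -/
theorem expect_mul_of_disjoint (r : ι → ℝ) {A B : Finset ι} (hAB : Disjoint A B)
    (F G : Finset ι → ℝ) :
    expect r (fun H => F (H ∩ A) * G (H ∩ B)) =
      expect r (fun H => F (H ∩ A)) * expect r (fun H => G (H ∩ B)) := by
  have key : ∀ H : Finset ι, (H \ A) ∩ B = H ∩ B := fun H => by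
    ext e
    have : e ∈ A → e ∉ B := fun h1 h2 => Finset.disjoint_left.1 hAB h1 h2
    simp only [Finset.mem_inter, Finset.mem_sdiff]
    tauto
  have h1 := expect_inter_mul_sdiff r A F (fun T => G (T ∩ B))
  have h2 := expect_inter_mul_sdiff r A (fun _ => 1) (fun T => G (T ∩ B))
  simp only [key, one_mul, mul_one, sum_bernWeight] at h1 h2
  rw [h1, h2, expect_inter]

theorem expect_card_inter {r : ι → ℝ} {A : Finset ι} {p : ℝ} (h : ∀ e ∈ A, r e = p) (j : ℕ) :
    expect r (fun H => if (H ∩ A).card = j then 1 else 0) =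
      (A.card.choose j : ℝ) * (p ^ j * (1 - p) ^ (A.card - j)) := by
  rw [← sum_bernWeight_card h]
  exact expect_inter r A (fun H => if H.card = j then 1 else 0)

theorem expect_mem (r : ι → ℝ) (e : ι) : expect r (fun H => if e ∈ H then 1 else 0) = r e := by
  have h := expect_card_inter (r := r) (A := {e}) (p := r e) (by simp) 1
  have : ∀ H : Finset ι, (H ∩ {e}).card = 1 ↔ e ∈ H := fun H => by
    by_cases he : e ∈ H
    · simp [he]
    · simp [he]
  simpa [this] using h

/-- Tensorization of the Bhattacharyya coefficient of two product laws. -/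
theorem sum_sqrt_bernWeight_mul {r s : ι → ℝ} (hr0 : ∀ e, 0 ≤ r e) (hr1 : ∀ e, r e ≤ 1)
    (hs0 : ∀ e, 0 ≤ s e) (hs1 : ∀ e, s e ≤ 1) :
    ∑ H, √(bernWeight r Finset.univ H * bernWeight s Finset.univ H) =
      ∏ e, (√(r e * s e) + √((1 - r e) * (1 - s e))) := by
  rw [Finset.prod_add, Finset.powerset_univ]
  refine Finset.sum_congr rfl fun H _ => ?_
  rw [bernWeight_of_subset (Finset.subset_univ _), bernWeight_of_subset (Finset.subset_univ _),
    mul_mul_mul_comm, ← Finset.prod_mul_distrib, ← Finset.prod_mul_distrib,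
    Real.sqrt_mul (Finset.prod_nonneg fun e _ => mul_nonneg (hr0 e) (hs0 e)),
    Real.sqrt_eq_rpow, Real.sqrt_eq_rpow,
    ← Real.finsetProd_rpow _ _ fun e _ => mul_nonneg (hr0 e) (hs0 e),
    ← Real.finsetProd_rpow _ _ fun e _ =>
      mul_nonneg (sub_nonneg.2 (hr1 e)) (sub_nonneg.2 (hs1 e))]
  simp only [Real.sqrt_eq_rpow]

end RandomSubset

/-! ### Sets through a given vertex -/

section Star

variable {n k : ℕ}

/-- The `k`-subsets that contain `u` and whose other elements all lie in `P`. -/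
def star (k : ℕ) (u : Fin n) (P : Finset (Fin n)) : Finset (KSubset n k) :=
  Finset.univ.filter fun e => u ∈ e.1 ∧ ∀ v ∈ e.1, v ≠ u → v ∈ P

theorem mem_star {u : Fin n} {P : Finset (Fin n)} {e : KSubset n k} :
    e ∈ star k u P ↔ u ∈ e.1 ∧ ∀ v ∈ e.1, v ≠ u → v ∈ P := by
  simp [star]

theorem card_star (hk : 1 ≤ k) {u : Fin n} {P : Finset (Fin n)} (hu : u ∉ P) :
    (star k u P).card = P.card.choose (k - 1) := by
  rw [← Finset.card_powersetCard]
  refine Finset.card_bij' (fun e _ => e.1.erase u)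
    (fun T hT => ⟨insert u T, ?_⟩) ?_ ?_ ?_ ?_
  · obtain ⟨h1, h2⟩ := Finset.mem_powersetCard.1 hT
    rw [Finset.card_insert_of_notMem fun h => hu (h1 h), h2]
    omega
  · intro e he
    obtain ⟨h1, h2⟩ := mem_star.1 he
    refine Finset.mem_powersetCard.2 ⟨fun v hv => ?_, ?_⟩
    · exact h2 v (Finset.mem_of_mem_erase hv) (Finset.ne_of_mem_erase hv)
    · rw [Finset.card_erase_of_mem h1, e.2]
  · intro T hT
    obtain ⟨h1, h2⟩ := Finset.mem_powersetCard.1 hT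
    refine mem_star.2 ⟨Finset.mem_insert_self _ _, fun v hv hvu => ?_⟩
    exact h1 ((Finset.mem_insert.1 hv).resolve_left hvu)
  · intro e he
    exact Subtype.ext (Finset.insert_erase (mem_star.1 he).1)
  · intro T hT
    obtain ⟨h1, h2⟩ := Finset.mem_powersetCard.1 hT
    exact Finset.erase_insert fun h => hu (h1 h)

theorem exists_ne_of_mem (hk : 2 ≤ k) (e : KSubset n k) (u : Fin n) : ∃ v ∈ e.1, v ≠ u := by
  have : 1 < e.1.card := by rw [e.2]; omega
  obtain ⟨v, hv, hvu⟩ := Finset.exists_mem_ne this u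
  exact ⟨v, hv, hvu⟩

/-- The `k`-subsets that contain `u` and at least one other element of `U`. -/
def touching (k : ℕ) (u : Fin n) (U : Finset (Fin n)) : Finset (KSubset n k) :=
  Finset.univ.filter fun e => u ∈ e.1 ∧ ∃ v ∈ e.1, v ≠ u ∧ v ∈ U

theorem mem_touching {u : Fin n} {U : Finset (Fin n)} {e : KSubset n k} :
    e ∈ touching k u U ↔ u ∈ e.1 ∧ ∃ v ∈ e.1, v ≠ u ∧ v ∈ U := by
  simp [touching]

/-- This is Pascal's rule: the sets through `u` and `v` are those through `u` minus those that
avoid `v`. -/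
theorem card_touching_singleton (hk : 2 ≤ k) {u v : Fin n} (huv : v ≠ u) :
    (touching k u {v}).card = (n - 2).choose (k - 2) := by
  have h : touching k u {v} =
      star k u (Finset.univ.erase u) \ star k u ((Finset.univ.erase u).erase v) := by
    ext e
    simp only [mem_touching, Finset.mem_sdiff, mem_star, Finset.mem_erase, Finset.mem_singleton]
    grind
  have hsub : star k u ((Finset.univ.erase u).erase v) ⊆ star k u (Finset.univ.erase u) := by
    intro e he
    simp only [mem_star, Finset.mem_erase] at he ⊢
    grind
  have hn : 2 ≤ n := by
    have h1 := u.2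
    have h2 := v.2
    have h3 : v.1 ≠ u.1 := fun h => huv (Fin.ext h)
    omega
  rw [h, Finset.card_sdiff_of_subset hsub, card_star (by omega) (by simp),
    card_star (by omega) (by simp), Finset.card_erase_of_mem (a := v) (by simp [huv]),
    Finset.card_erase_of_mem (Finset.mem_univ _), Finset.card_univ, Fintype.card_fin]
  obtain ⟨n, rfl⟩ := Nat.exists_eq_add_of_le hn
  obtain ⟨k, rfl⟩ := Nat.exists_eq_add_of_le hk
  have := Nat.choose_succ_succ n k
  rw [show 2 + n - 1 = n + 1 by omega, show 2 + k - 1 = k + 1 by omega,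
    show n + 1 - 1 = n by omega, show 2 + n - 2 = n by omega, show 2 + k - 2 = k by omega]
  simp only [Nat.succ_eq_add_one] at this
  omega

theorem card_touching_le (hk : 2 ≤ k) (u : Fin n) (U : Finset (Fin n)) :
    (touching k u U).card ≤ U.card * (n - 2).choose (k - 2) := by
  have h : touching k u U ⊆ (U.erase u).biUnion fun v => touching k u {v} := by
    intro e he
    simp only [Finset.mem_biUnion, mem_touching, Finset.mem_erase, Finset.mem_singleton] at he ⊢
    grind
  refine (Finset.card_le_card h).trans (Finset.card_biUnion_le.trans ?_)
  refine (Finset.sum_le_card_nsmul _ _ _ fun v hv =>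
    (card_touching_singleton hk (Finset.ne_of_mem_erase hv)).le).trans ?_
  exact Nat.mul_le_mul_right _ (Finset.card_erase_le)

end Star

/-! ### Binomial coefficients -/

section Choose

theorem two_pow_mul_choose_le (a j : ℕ) : 2 ^ j * a.choose j ≤ (2 * a).choose j := by
  have h : ∀ j, 2 ^ j * a.descFactorial j ≤ (2 * a).descFactorial j := by
    intro j
    induction j with
    | zero => simp
    | succ j ih =>
      rw [Nat.descFactorial_succ, Nat.descFactorial_succ, pow_succ]
      calc 2 ^ j * 2 * ((a - j) * a.descFactorial j)
          = (2 * (a - j)) * (2 ^ j * a.descFactorial j) := by ring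
        _ ≤ (2 * a - j) * (2 * a).descFactorial j := Nat.mul_le_mul (by omega) ih
  have h' := h j
  rw [Nat.descFactorial_eq_factorial_mul_choose, Nat.descFactorial_eq_factorial_mul_choose] at h'
  refine Nat.le_of_mul_le_mul_left ?_ (Nat.factorial_pos j)
  linarith [h']

/-- Choosing `j` out of a slightly smaller half keeps nearly the fraction `2⁻ʲ` of all choices. -/
theorem pow_mul_choose_le {m t j : ℕ} {y : ℝ} (hy : 0 ≤ y) (h : y * m + t + j ≤ m) :
    y ^ j * ((2 * m - 1).choose j : ℝ) ≤ 2 ^ j * ((m - t).choose j : ℝ) := by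
  have hle : t + j ≤ m := by
    have : ((t + j : ℕ) : ℝ) ≤ m := by
      push_cast
      nlinarith [mul_nonneg hy (Nat.cast_nonneg (α := ℝ) m)]
    exact_mod_cast this
  have h2 : ((2 * m - 1).choose j : ℝ) ≤ ((2 * m - 1 : ℕ) : ℝ) ^ j / j.factorial :=
    Nat.choose_le_pow_div j (2 * m - 1)
  have hf : (0 : ℝ) < j.factorial := by exact_mod_cast j.factorial_pos
  rw [le_div_iff₀ hf] at h2
  have h1 : ((m - t + 1 - j : ℕ) : ℝ) ^ j ≤ j.factorial * ((m - t).choose j : ℝ) :=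
    (div_le_iff₀' hf).1 (Nat.pow_le_choose j (m - t))
  have h3 : ((2 * m - 1 : ℕ) : ℝ) ≤ 2 * m := by exact_mod_cast Nat.sub_le _ _
  have h4 : y * m ≤ ((m - t + 1 - j : ℕ) : ℝ) := by
    have : m - t + 1 - j = m + 1 - (t + j) := by omega
    rw [this, Nat.cast_sub (by omega)]
    push_cast
    linarith
  have h5 : ((2 * m - 1 : ℕ) : ℝ) ^ j ≤ (2 * m) ^ j := pow_le_pow_left₀ (Nat.cast_nonneg _) h3 j
  have h6 : (y * m) ^ j ≤ ((m - t + 1 - j : ℕ) : ℝ) ^ j := pow_le_pow_left₀ (by positivity) h4 j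
  refine le_of_mul_le_mul_right ?_ hf
  calc y ^ j * ((2 * m - 1).choose j : ℝ) * j.factorial
      = y ^ j * (((2 * m - 1).choose j : ℝ) * j.factorial) := by ring
    _ ≤ y ^ j * (2 * m) ^ j := by gcongr; exact h2.trans h5
    _ = 2 ^ j * (y * m) ^ j := by rw [mul_pow, mul_pow]; ring
    _ ≤ 2 ^ j * (j.factorial * ((m - t).choose j : ℝ)) := by gcongr; exact h6.trans h1
    _ = 2 ^ j * ((m - t).choose j : ℝ) * j.factorial := by ring

end Choose

/-! ### Likelihoods and clusters -/

section Likelihood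

variable {n k : ℕ} {p q : ℝ}

theorem likelihood_eq_bernWeight (p q : ℝ) (σ : Labeling n) (H : Hypergraph n k) :
    likelihood p q σ H = bernWeight (edgeProb p q σ) Finset.univ H := by
  unfold likelihood bernWeight
  refine Finset.prod_congr rfl fun e _ => ?_
  by_cases h : e ∈ H <;> simp [h]

theorem edgeProb_nonneg (hp : 0 ≤ p) (hq : 0 ≤ q) (σ : Labeling n) (e : KSubset n k) :
    0 ≤ edgeProb p q σ e := by
  unfold edgeProb; split_ifs <;> assumption

theorem edgeProb_le {c : ℝ} (hp : p ≤ c) (hq : q ≤ c) (σ : Labeling n) (e : KSubset n k) :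
    edgeProb p q σ e ≤ c := by
  unfold edgeProb; split_ifs <;> assumption

theorem likelihood_nonneg (hp0 : 0 ≤ p) (hp1 : p ≤ 1) (hq0 : 0 ≤ q) (hq1 : q ≤ 1)
    (σ : Labeling n) (H : Hypergraph n k) : 0 ≤ likelihood p q σ H := by
  rw [likelihood_eq_bernWeight]
  exact bernWeight_nonneg (edgeProb_nonneg hp0 hq0 σ) (edgeProb_le hp1 hq1 σ) _ _

theorem sum_likelihood (p q : ℝ) (σ : Labeling n) :
    ∑ H : Hypergraph n k, likelihood p q σ H = 1 := by
  simp only [likelihood_eq_bernWeight]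
  simpa [expect] using expect_one (edgeProb (k := k) p q σ)

theorem inCluster_neg {σ : Labeling n} {e : KSubset n k} : InCluster (-σ) e ↔ InCluster σ e := by
  simp [InCluster]

theorem edgeProb_neg (p q : ℝ) (σ : Labeling n) (e : KSubset n k) :
    edgeProb p q (-σ) e = edgeProb p q σ e := by
  unfold edgeProb
  by_cases h : InCluster σ e <;> simp [h, inCluster_neg]

theorem likelihood_neg (p q : ℝ) (σ : Labeling n) (H : Hypergraph n k) :
    likelihood p q (-σ) H = likelihood p q σ H := by
  simp only [likelihood, edgeProb_neg]

theorem mem_balanced {σ : Labeling n} : σ ∈ balanced n ↔ Balanced σ := by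
  simp [balanced]

theorem Balanced.neg {σ : Labeling n} (h : Balanced σ) : Balanced (-σ) := by
  simpa [Balanced] using h

theorem balanced_nonempty (hn : Even n) : (balanced n).Nonempty := by
  refine ⟨fun v => (-1) ^ (v : ℕ), mem_balanced.2 ?_⟩
  unfold Balanced
  push_cast
  rw [Fin.sum_univ_eq_sum_range (fun i => (-1 : ℤ) ^ i), neg_one_geom_sum, if_pos hn]

/-- The vertices with the label `s`. -/
def cluster (σ : Labeling n) (s : ℤˣ) : Finset (Fin n) := Finset.univ.filter fun v => σ v = s

theorem mem_cluster {σ : Labeling n} {s : ℤˣ} {v : Fin n} : v ∈ cluster σ s ↔ σ v = s := by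
  simp [cluster]

theorem sum_eq_card_sub_card (σ : Labeling n) (S : Finset (Fin n)) :
    ∑ v ∈ S, (σ v : ℤ) =
      ((S.filter fun v => σ v = 1).card : ℤ) - ((S.filter fun v => σ v = -1).card : ℤ) := by
  rw [Finset.card_filter, Finset.card_filter]
  push_cast
  rw [← Finset.sum_sub_distrib]
  refine Finset.sum_congr rfl fun v _ => ?_
  rcases Int.units_eq_one_or (σ v) with h | h <;> rw [h] <;> decide

theorem card_filter_add_card_filter (σ : Labeling n) (S : Finset (Fin n)) :
    (S.filter fun v => σ v = 1).card + (S.filter fun v => σ v = -1).card = S.card := by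
  rw [← Finset.card_union_of_disjoint]
  · congr 1
    ext v
    rcases Int.units_eq_one_or (σ v) with h | h <;> simp [h]
  · refine Finset.disjoint_filter.2 fun v _ h h' => ?_
    rw [h] at h'
    exact absurd h' (by decide)

theorem Balanced.two_mul_card_cluster {σ : Labeling n} (h : Balanced σ) (s : ℤˣ) :
    2 * (cluster σ s).card = n := by
  have h1 := sum_eq_card_sub_card σ Finset.univ
  have h2 := card_filter_add_card_filter σ Finset.univ
  rw [show ∑ v, (σ v : ℤ) = 0 from h] at h1
  simp only [Finset.card_univ, Fintype.card_fin] at h2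
  rcases Int.units_eq_one_or s with rfl | rfl <;> unfold cluster <;> omega

end Likelihood

/-! ### Bhattacharyya coefficients -/

section Affinity

/-- The Bhattacharyya coefficient of two Bernoulli laws, against their Hellinger distance. -/
theorem affinity_le {p q : ℝ} (hp0 : 0 ≤ p) (hp1 : p ≤ 1) (hq0 : 0 ≤ q) (hq1 : q ≤ 1) :
    √(p * q) + √((1 - p) * (1 - q)) ≤ Real.exp (-((√p - √q) ^ 2 / 2)) := by
  have h1 : √((1 - p) * (1 - q)) ≤ 1 - (p + q) / 2 := by
    refine Real.sqrt_le_iff.2 ⟨by linarith, ?_⟩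
    nlinarith [sq_nonneg (p - q)]
  have h2 := Real.add_one_le_exp (-((√p - √q) ^ 2 / 2))
  have h3 : (√p - √q) ^ 2 = p + q - 2 * √(p * q) := by
    rw [Real.sqrt_mul hp0, sub_sq, Real.sq_sqrt hp0, Real.sq_sqrt hq0]
    ring
  linarith

/-- Every set whose status differs between `σ` and `x` contributes one Bernoulli affinity; the sets
of equal status contribute at most `1`. -/
theorem sum_sqrt_likelihood_mul_le {n k : ℕ} {p q : ℝ} (hp0 : 0 ≤ p) (hp1 : p ≤ 1) (hq0 : 0 ≤ q)
    (hq1 : q ≤ 1) (σ x : Labeling n) (D : Finset (KSubset n k))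
    (hD : ∀ e ∈ D, ¬ (InCluster σ e ↔ InCluster x e)) :
    ∑ H : Hypergraph n k, √(likelihood p q σ H * likelihood p q x H) ≤
      Real.exp (-(D.card * ((√p - √q) ^ 2 / 2))) := by
  simp only [likelihood_eq_bernWeight]
  have hσ0 := edgeProb_nonneg (k := k) hp0 hq0 σ
  have hσ1 := edgeProb_le (k := k) hp1 hq1 σ
  have hx0 := edgeProb_nonneg (k := k) hp0 hq0 x
  have hx1 := edgeProb_le (k := k) hp1 hq1 x
  rw [sum_sqrt_bernWeight_mul hσ0 hσ1 hx0 hx1, ← mul_neg, Real.exp_nat_mul,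
    ← Finset.prod_const, ← Finset.prod_mul_prod_compl D]
  refine (mul_le_of_le_one_right (Finset.prod_nonneg fun e _ => by positivity) ?_).trans ?_
  · refine Finset.prod_le_one (fun e _ => by positivity) fun e _ => ?_
    refine (affinity_le (hσ0 e) (hσ1 e) (hx0 e) (hx1 e)).trans (Real.exp_le_one_iff.2 ?_)
    have := sq_nonneg (√(edgeProb p q σ e) - √(edgeProb p q x e))
    linarith
  · refine Finset.prod_le_prod (fun e _ => by positivity) fun e he => ?_
    have h := affinity_le (hσ0 e) (hσ1 e) (hx0 e) (hx1 e)
    have h' := hD e he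
    refine h.trans (le_of_eq ?_)
    unfold edgeProb
    by_cases h1 : InCluster σ e <;> by_cases h2 : InCluster x e <;>
      simp only [h1, h2, if_true, if_false]
    · exact absurd (iff_of_true h1 h2) h'
    · rw [← neg_sub √p √q, neg_sq]
    · exact absurd (iff_of_false h1 h2) h'

end Affinity

/-! ### Two balanced labelings -/

section Flips

variable {n k : ℕ}

/-- The vertices at which two labelings differ. -/
def flips (σ x : Labeling n) : Finset (Fin n) := Finset.univ.filter fun v => x v ≠ σ v

theorem mem_flips {σ x : Labeling n} {v : Fin n} : v ∈ flips σ x ↔ x v ≠ σ v := by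
  simp [flips]

theorem eq_neg_of_ne {s t : ℤˣ} (h : s ≠ t) : s = -t := by
  rcases Int.units_eq_one_or s with rfl | rfl <;> rcases Int.units_eq_one_or t with rfl | rfl <;>
    simp at *

theorem flips_injective (σ : Labeling n) : Function.Injective (flips σ) := by
  intro x y h
  funext v
  have hv := Finset.ext_iff.1 h v
  simp only [mem_flips, ne_eq, not_iff_not] at hv
  by_cases hx : x v = σ v
  · rw [hx, hv.1 hx]
  · rw [eq_neg_of_ne hx, eq_neg_of_ne fun hy => hx (hv.2 hy)]

theorem flips_neg (σ x : Labeling n) : flips σ (-x) = (flips σ x)ᶜ := by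
  ext v
  simp only [mem_flips, Finset.mem_compl, Pi.neg_apply, not_not]
  rcases Int.units_eq_one_or (x v) with h1 | h1 <;>
    rcases Int.units_eq_one_or (σ v) with h3 | h3 <;> rw [h1, h3] <;> decide

theorem flips_eq_empty {σ x : Labeling n} (h : flips σ x = ∅) : x = σ := by
  funext v
  by_contra hv
  exact absurd (mem_flips.2 hv) (by simp [h])

/-- Balanced labelings differ at equally many vertices of each cluster. -/
theorem two_mul_card_cluster_sdiff_flips {σ x : Labeling n} (hσ : Balanced σ) (hx : Balanced x)
    (s : ℤˣ) : 2 * (cluster σ s \ flips σ x).card + (flips σ x).card = n := by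
  have h1 : ∑ v ∈ flips σ x, (σ v : ℤ) = 0 := by
    have : ∀ v, (x v : ℤ) = σ v - 2 * (if v ∈ flips σ x then (σ v : ℤ) else 0) := by
      intro v
      by_cases h : x v = σ v
      · simp [mem_flips, h]
      · have := eq_neg_of_ne h
        simp [mem_flips, this]
        ring
    have hx' : ∑ v, (x v : ℤ) = 0 := hx
    have hσ' : ∑ v, (σ v : ℤ) = 0 := hσ
    rw [Finset.sum_congr rfl fun v _ => this v, Finset.sum_sub_distrib, hσ', ← Finset.mul_sum,
      Finset.sum_ite_mem, Finset.univ_inter] at hx'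
    linarith
  have h2 := sum_eq_card_sub_card σ (flips σ x)
  have h3 := card_filter_add_card_filter σ (flips σ x)
  have h4 : (cluster σ s \ flips σ x).card + ((flips σ x).filter fun v => σ v = s).card =
      (cluster σ s).card := by
    rw [← Finset.card_sdiff_add_card_inter (cluster σ s) (flips σ x)]
    congr 2
    ext v
    simp [mem_cluster, and_comm]
  have h5 := hσ.two_mul_card_cluster s
  rcases Int.units_eq_one_or s with rfl | rfl <;> omega

/-- The sets with one vertex in `flips σ x` and all others in one remaining half change
status: this gives many sets that are in-cluster for exactly one of two balanced labelings. -/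
theorem exists_changed (hk : 2 ≤ k) {m : ℕ} (hn : n = 2 * m) {σ x : Labeling n} (hσ : Balanced σ)
    (hx : Balanced x) :
    ∃ D : Finset (KSubset n k), (∀ e ∈ D, ¬ (InCluster σ e ↔ InCluster x e)) ∧
      D.card = 2 * ((flips σ x).card * (m - (flips σ x).card / 2).choose (k - 1)) := by
  set S := flips σ x with hS
  have hcard : ∀ s, (cluster σ s \ S).card = m - S.card / 2 := fun s => by
    have := two_mul_card_cluster_sdiff_flips hσ hx s
    rw [← hS] at this
    omega
  refine ⟨S.biUnion fun u => Finset.univ.biUnion fun s : ℤˣ => star k u (cluster σ s \ S),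
    ?_, ?_⟩
  · intro e he
    simp only [Finset.mem_biUnion, Finset.mem_univ, true_and, mem_star, Finset.mem_sdiff,
      mem_cluster] at he
    obtain ⟨u, huS, s, hu, hv⟩ := he
    obtain ⟨w, hw, hwu⟩ := exists_ne_of_mem hk e u
    have hxv : ∀ v ∈ e.1, v ≠ u → x v = s := fun v hve hvu => by
      have h1 := hv v hve hvu
      have h2 : x v = σ v := by
        by_contra h
        exact h1.2 (mem_flips.2 h)
      rw [h2, h1.1]
    have hxu : x u ≠ σ u := mem_flips.1 huS
    have iffσ : InCluster σ e ↔ σ u = s := by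
      refine ⟨fun h => (h u hu w hw).trans (hv w hw hwu).1, fun h a ha b hb => ?_⟩
      have : ∀ a ∈ e.1, σ a = s := fun a ha => by
        by_cases hau : a = u
        · rw [hau, h]
        · exact (hv a ha hau).1
      rw [this a ha, this b hb]
    have iffx : InCluster x e ↔ x u = s := by
      refine ⟨fun h => (h u hu w hw).trans (hxv w hw hwu), fun h a ha b hb => ?_⟩
      have : ∀ a ∈ e.1, x a = s := fun a ha => by
        by_cases hau : a = u
        · rw [hau, h]
        · exact hxv a ha hau
      rw [this a ha, this b hb]
    rw [iffσ, iffx]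
    intro h
    by_cases hs : σ u = s
    · exact hxu ((h.1 hs).trans hs.symm)
    · have h1 := eq_neg_of_ne hs
      have h2 := eq_neg_of_ne fun h' => hs (h.2 h')
      exact hxu (h2.trans h1.symm)
  · have hd : ∀ u ∈ S, ∀ s, u ∉ cluster σ s \ S := fun u hu s h => (Finset.mem_sdiff.1 h).2 hu
    have hu : ∀ u ∈ S, (Finset.univ.biUnion fun s : ℤˣ =>
        star k u (cluster σ s \ S)).card = 2 * (m - S.card / 2).choose (k - 1) := by
      intro u hu
      rw [Finset.card_biUnion, Finset.sum_congr rfl fun s _ => card_star (by omega) (hd u hu s),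
        Finset.sum_congr rfl fun s _ => by rw [hcard s], Finset.sum_const, Finset.card_univ,
        smul_eq_mul]
      · congr 1
      · intro s _ s' _ hss
        refine Finset.disjoint_left.2 fun e he he' => hss ?_
        obtain ⟨w, hw, hwu⟩ := exists_ne_of_mem hk e u
        have h1 := (mem_star.1 he).2 w hw hwu
        have h2 := (mem_star.1 he').2 w hw hwu
        rw [Finset.mem_sdiff, mem_cluster] at h1 h2
        rw [← h1.1, h2.1]
    rw [Finset.card_biUnion, Finset.sum_congr rfl hu, Finset.sum_const, smul_eq_mul]
    · ring
    · intro u hu u' hu' huu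
      refine Finset.disjoint_left.2 fun e he he' => ?_
      simp only [Finset.mem_biUnion, Finset.mem_univ, true_and, mem_star] at he he'
      obtain ⟨s, -, h1⟩ := he
      obtain ⟨s', h2, -⟩ := he'
      exact hd u' hu' s (h1 u' h2 huu.symm)

end Flips

/-! ### The union bound for maximum-likelihood estimators -/

section MaximumLikelihood

variable {n k : ℕ} {p q : ℝ}

open scoped Classical in
/-- It suffices to bound the failure probability for every given balanced `σ`. -/
theorem prob_le_of_forall {E : Labeling n → Hypergraph n k → Prop} {c : ℝ} (hc : 0 ≤ c)
    (h : ∀ σ, Balanced σ → ∑ H : Hypergraph n k, (if E σ H then likelihood p q σ H else 0) ≤ c) :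
    prob n k p q E ≤ c := by
  unfold prob
  rw [← Finset.mul_sum]
  rcases (balanced n).eq_empty_or_nonempty with h0 | h0
  · simpa [h0] using hc
  · have h1 : (0 : ℝ) < (balanced n).card := by exact_mod_cast h0.card_pos
    have h2 := Finset.sum_le_card_nsmul (balanced n)
      (fun σ => ∑ H : Hypergraph n k, (if E σ H then likelihood p q σ H else 0)) c
      fun σ hσ => h σ (mem_balanced.1 hσ)
    rw [nsmul_eq_mul] at h2
    rw [one_div, inv_mul_le_iff₀ h1]
    exact h2

theorem exists_isMLE (hn : Even n) (p q : ℝ) : ∃ τ : Estimator n k, IsMLE p q τ := by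
  have : ∀ H : Hypergraph n k, ∃ y, Balanced y ∧
      ∀ x, Balanced x → likelihood p q x H ≤ likelihood p q y H := fun H => by
    obtain ⟨y, hy, hmax⟩ := Finset.exists_max_image (balanced n) (fun x => likelihood p q x H)
      (balanced_nonempty hn)
    exact ⟨y, mem_balanced.1 hy, fun x hx => hmax x (mem_balanced.2 hx)⟩
  choose τ hτ using this
  exact ⟨τ, hτ⟩

/-- The union bound over the set of vertices that a maximum-likelihood estimator mislabels; up to
a sign this set has at most half of the vertices. -/
theorem failProb_le_of_isMLE (hk : 2 ≤ k) {m : ℕ} (hn : n = 2 * m) (hp0 : 0 ≤ p) (hp1 : p ≤ 1)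
    (hq0 : 0 ≤ q) (hq1 : q ≤ 1) {τ : Estimator n k} (hτ : IsMLE p q τ) :
    failProb p q τ ≤ ∑ S : Finset (Fin n) with S.Nonempty ∧ S.card ≤ m,
      Real.exp (-((S.card : ℝ) * ((m - S.card / 2).choose (k - 1) : ℝ) * (√p - √q) ^ 2)) := by
  classical
  refine prob_le_of_forall (Finset.sum_nonneg fun _ _ => (Real.exp_pos _).le) fun σ hσ => ?_
  set X : Finset (Labeling n) := (balanced n).filter
    fun x => (flips σ x).Nonempty ∧ (flips σ x).card ≤ m
  have hL := fun x : Labeling n => likelihood_nonneg (k := k) hp0 hp1 hq0 hq1 x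
  have hle : ∀ H : Hypergraph n k, ¬ (τ H = σ ∨ τ H = -σ) →
      likelihood p q σ H ≤ ∑ x ∈ X, √(likelihood p q σ H * likelihood p q x H) := by
    intro H hfail
    obtain ⟨y, hyX, hy⟩ : ∃ y ∈ X, likelihood p q σ H ≤ likelihood p q y H := by
      have hmax := (hτ H).2 σ hσ
      have hcard : (flips σ (τ H)).card + (flips σ (τ H))ᶜ.card = n := by simp
      rw [not_or] at hfail
      rcases le_total (flips σ (τ H)).card m with h | h
      · refine ⟨τ H, Finset.mem_filter.2 ⟨mem_balanced.2 (hτ H).1, ?_, h⟩, hmax⟩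
        exact Finset.nonempty_iff_ne_empty.2 fun h0 => hfail.1 (flips_eq_empty h0)
      · refine ⟨-τ H, Finset.mem_filter.2 ⟨mem_balanced.2 (hτ H).1.neg, ?_, ?_⟩, ?_⟩
        · refine Finset.nonempty_iff_ne_empty.2 fun h0 => hfail.2 ?_
          rw [← flips_eq_empty h0, neg_neg]
        · rw [flips_neg]
          omega
        · rwa [likelihood_neg]
    refine le_trans ?_ (Finset.single_le_sum
      (f := fun x => √(likelihood p q σ H * likelihood p q x H))
      (fun x _ => Real.sqrt_nonneg _) hyX)
    refine Real.le_sqrt_of_sq_le ?_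
    rw [sq]
    exact mul_le_mul_of_nonneg_left hy (hL σ H)
  calc _ ≤ ∑ H : Hypergraph n k, ∑ x ∈ X, √(likelihood p q σ H * likelihood p q x H) := by
        refine Finset.sum_le_sum fun H _ => ?_
        split_ifs with hfail
        · exact Finset.sum_nonneg fun _ _ => Real.sqrt_nonneg _
        · exact hle H hfail
    _ = ∑ x ∈ X, ∑ H : Hypergraph n k, √(likelihood p q σ H * likelihood p q x H) :=
        Finset.sum_comm
    _ ≤ ∑ x ∈ X, Real.exp (-(((flips σ x).card : ℝ) *
          ((m - (flips σ x).card / 2).choose (k - 1) : ℝ) * (√p - √q) ^ 2)) := by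
        refine Finset.sum_le_sum fun x hx => ?_
        obtain ⟨D, hD, hDc⟩ := exists_changed hk hn hσ (mem_balanced.1 (Finset.mem_filter.1 hx).1)
        refine (sum_sqrt_likelihood_mul_le hp0 hp1 hq0 hq1 σ x D hD).trans (le_of_eq ?_)
        rw [hDc]
        push_cast
        ring_nf
    _ = ∑ S ∈ X.image (flips σ), Real.exp (-((S.card : ℝ) *
          ((m - S.card / 2).choose (k - 1) : ℝ) * (√p - √q) ^ 2)) := by
        rw [Finset.sum_image fun x _ y _ h => flips_injective σ h]
    _ ≤ ∑ S : Finset (Fin n) with S.Nonempty ∧ S.card ≤ m, Real.exp (-((S.card : ℝ) *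
          ((m - S.card / 2).choose (k - 1) : ℝ) * (√p - √q) ^ 2)) := by
        refine Finset.sum_le_sum_of_subset_of_nonneg ?_ fun _ _ _ => (Real.exp_pos _).le
        intro S hS
        obtain ⟨x, hx, rfl⟩ := Finset.mem_image.1 hS
        exact Finset.mem_filter.2 ⟨Finset.mem_univ _, (Finset.mem_filter.1 hx).2⟩

end MaximumLikelihood

/-! ### The edge probabilities -/

section Rate

/-- A linear lower bound, enough to see that the edge probabilities tend to `0`. -/
theorem sub_lt_choose {N j : ℕ} (hj : 1 ≤ j) (h : j ≤ N) : N - j < N.choose j := by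
  induction N with
  | zero => omega
  | succ N ih =>
    obtain ⟨i, rfl⟩ := Nat.exists_eq_add_of_le' hj
    rw [Nat.choose_succ_succ]
    have h1 : 0 < N.choose i := Nat.choose_pos (by omega)
    rcases Nat.lt_or_ge N (i + 1) with h2 | h2
    · simp only [Nat.succ_eq_add_one]
      omega
    · have := ih h2
      simp only [Nat.succ_eq_add_one]
      omega

variable {k : ℕ} {a : ℝ}

theorem half_le_choose (hk : 2 ≤ k) {n : ℕ} (hn : 2 * k ≤ n) :
    (n : ℝ) / 2 ≤ ((n - 1).choose (k - 1) : ℝ) := by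
  have h := sub_lt_choose (N := n - 1) (j := k - 1) (by omega) (by omega)
  have : n ≤ 2 * (n - 1).choose (k - 1) := by omega
  have h' : (n : ℝ) ≤ 2 * ((n - 1).choose (k - 1) : ℝ) := by exact_mod_cast this
  linarith

theorem rate_nonneg (ha : 0 ≤ a) (n : ℕ) : 0 ≤ rate k a n := by
  unfold rate
  have := Real.log_natCast_nonneg n
  positivity

theorem rate_le (hk : 2 ≤ k) (ha : 0 ≤ a) {n : ℕ} (hn : 2 * k ≤ n) :
    rate k a n ≤ 2 * a * (Real.log n / n) := by
  have h := half_le_choose hk hn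
  have hn0 : (0 : ℝ) < n := by exact_mod_cast (by omega : 0 < n)
  have h1 : 0 < (n : ℝ) / 2 := by positivity
  have hlog := Real.log_natCast_nonneg n
  unfold rate
  calc a * Real.log n / ((n - 1).choose (k - 1) : ℝ) ≤ a * Real.log n / ((n : ℝ) / 2) :=
        div_le_div_of_nonneg_left (by positivity) h1 h
    _ = 2 * a * (Real.log n / n) := by field_simp

theorem tendsto_log_nat : Tendsto (fun n : ℕ => Real.log n) atTop atTop :=
  Real.tendsto_log_atTop.comp tendsto_natCast_atTop_atTop

theorem tendsto_log_pow_div (j : ℕ) {b : ℝ} (hb : 0 < b) :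
    Tendsto (fun n : ℕ => Real.log n ^ j / (n : ℝ) ^ b) atTop (𝓝 0) := by
  have h := (isLittleO_log_rpow_rpow_atTop (s := b) (j : ℝ) hb).tendsto_div_nhds_zero
  have := h.comp (tendsto_natCast_atTop_atTop (R := ℝ))
  simpa [Function.comp_def] using this

theorem tendsto_rate (hk : 2 ≤ k) (ha : 0 ≤ a) : Tendsto (rate k a) atTop (𝓝 0) := by
  have h := (tendsto_log_pow_div 1 one_pos).const_mul (2 * a)
  simp only [pow_one, Real.rpow_one, mul_zero] at h
  refine squeeze_zero' (Eventually.of_forall fun n => rate_nonneg ha n) ?_ h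
  filter_upwards [eventually_ge_atTop (2 * k)] with n hn using rate_le hk ha hn

theorem rate_mul_choose {n : ℕ} (hn : k ≤ n) :
    rate k a n * ((n - 1).choose (k - 1) : ℝ) = a * Real.log n := by
  have : ((n - 1).choose (k - 1) : ℝ) ≠ 0 := by
    exact_mod_cast (Nat.choose_pos (by omega)).ne'
  unfold rate
  field_simp

/-- The squared Hellinger-type distance of the two rates is `I(α, β)` in the natural units. -/
theorem sq_sub_sqrt_rate {α β : ℝ} (hα : 0 ≤ α) (hβ : 0 ≤ β) {n : ℕ} (hn : k ≤ n) :
    (√(rate k α n) - √(rate k β n)) ^ 2 * ((n - 1).choose (k - 1) : ℝ) =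
      2 ^ (k - 1) * (threshold k α β * Real.log n) := by
  have hB : ((n - 1).choose (k - 1) : ℝ) ≠ 0 := by
    exact_mod_cast (Nat.choose_pos (by omega)).ne'
  have hl : 0 ≤ Real.log n / ((n - 1).choose (k - 1) : ℝ) :=
    div_nonneg (Real.log_natCast_nonneg n) (Nat.cast_nonneg _)
  have h : ∀ a, 0 ≤ a → √(rate k a n) = √a * √(Real.log n / ((n - 1).choose (k - 1) : ℝ)) :=
    fun a ha => by rw [← Real.sqrt_mul ha]; unfold rate; rw [mul_div_assoc]
  rw [h α hα, h β hβ, ← sub_mul, mul_pow, Real.sq_sqrt hl]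
  unfold threshold
  field_simp

end Rate

/-! ### Asymptotics of the union bound -/

section UnionBound

/-- Small sets contribute `z^|S|`; a set of linear size contributes less than `w`. -/
theorem exp_neg_mul_choose_le {m j s : ℕ} {D I L y : ℝ} (hD0 : 0 ≤ D) (hI : 0 ≤ I) (hL : 0 ≤ L)
    (hD : D * ((2 * m - 1).choose j : ℝ) = 2 ^ j * (I * L)) (hy0 : 0 ≤ y)
    (hs : s ≤ m) (hm4 : 4 * j ≤ m) (hm : 2 * j ≤ (1 - y) * m) :
    Real.exp (-(s * ((m - s / 2).choose j : ℝ) * D)) ≤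
      Real.exp (-(I * y ^ j * L)) ^ s +
        Real.exp (-(I * (1 / 4) ^ j * ((1 - y) / 4) * ((2 * m : ℕ) : ℝ) * L)) := by
  -- Used with `y' = y` for small `s`, and with `y' = 1 / 4` for all `s ≤ m`.
  have key : ∀ y' : ℝ, 0 ≤ y' → y' * m + (s / 2 : ℕ) + j ≤ m →
      I * y' ^ j * L ≤ ((m - s / 2).choose j : ℝ) * D := by
    intro y' hy' h
    have h1 := mul_le_mul_of_nonneg_right (pow_mul_choose_le hy' h) hD0
    have h2 : (0 : ℝ) < 2 ^ j := by positivity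
    refine le_of_mul_le_mul_left ?_ h2
    calc 2 ^ j * (I * y' ^ j * L) = y' ^ j * (D * ((2 * m - 1).choose j : ℝ)) := by
          rw [hD]; ring
      _ = y' ^ j * ((2 * m - 1).choose j : ℝ) * D := by ring
      _ ≤ _ := h1
      _ = _ := by ring
  by_cases h : y * m + (s / 2 : ℕ) + j ≤ m
  · have h1 := key y hy0 h
    refine le_add_of_le_of_nonneg ?_ (Real.exp_pos _).le
    rw [← Real.exp_nat_mul]
    refine Real.exp_le_exp.2 ?_
    have := mul_le_mul_of_nonneg_left h1 (Nat.cast_nonneg (α := ℝ) s)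
    linarith
  · push Not at h
    have hs2 : 4 * (1 / 4 * (m : ℝ) + (s / 2 : ℕ) + j) ≤ 4 * m := by
      have : m + 4 * (s / 2) + 4 * j ≤ 4 * m := by omega
      have : ((m + 4 * (s / 2) + 4 * j : ℕ) : ℝ) ≤ ((4 * m : ℕ) : ℝ) := by exact_mod_cast this
      push_cast at this ⊢
      linarith
    have h1 := key (1 / 4) (by norm_num) (by linarith)
    refine le_add_of_nonneg_of_le (pow_nonneg (Real.exp_pos _).le _) ?_
    refine Real.exp_le_exp.2 ?_
    have hss : ((s / 2 : ℕ) : ℝ) ≤ s := by exact_mod_cast Nat.div_le_self _ _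
    have h2 : (1 - y) / 4 * ((2 * m : ℕ) : ℝ) ≤ s := by
      push_cast
      linarith
    have h3 : 0 ≤ I * (1 / 4) ^ j * L := by positivity
    have h4 := mul_le_mul_of_nonneg_left h1 (Nat.cast_nonneg (α := ℝ) s)
    have h5 := mul_le_mul_of_nonneg_right h2 h3
    linarith

theorem sum_pow_card_add_le {n m : ℕ} {z w : ℝ} (hz : 0 ≤ z) (hw : 0 ≤ w) :
    ∑ S : Finset (Fin n) with S.Nonempty ∧ S.card ≤ m, (z ^ S.card + w) ≤
      ((1 + z) ^ n - 1) + 2 ^ n * w := by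
  rw [Finset.sum_add_distrib]
  refine add_le_add ?_ ?_
  · have h := Fintype.sum_pow_mul_eq_add_pow (Fin n) z 1
    simp only [one_pow, mul_one, Fintype.card_fin] at h
    rw [add_comm, ← h, ← Finset.add_sum_erase _ _ (Finset.mem_univ ∅)]
    simp only [Finset.card_empty, pow_zero, add_sub_cancel_left]
    refine Finset.sum_le_sum_of_subset_of_nonneg (fun S hS => ?_) fun _ _ _ => by positivity
    simp only [Finset.mem_filter, Finset.mem_univ, true_and, Finset.mem_erase, and_true] at hS ⊢
    exact hS.1.ne_empty
  · rw [Finset.sum_const, nsmul_eq_mul]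
    refine mul_le_mul_of_nonneg_right ?_ hw
    have := Finset.card_le_univ (Finset.univ.filter fun S : Finset (Fin n) =>
      S.Nonempty ∧ S.card ≤ m)
    rw [Fintype.card_finset, Fintype.card_fin] at this
    exact_mod_cast this

/-- The first summand is of order `n ^ (-a')`, the second one decays faster than any power. -/
theorem eventually_sum_le_rpow {a a' κ : ℝ} (ha : 0 < a) (haa : a < a') (hκ : 0 < κ) :
    ∀ᶠ n : ℕ in atTop, ((1 + Real.exp (-((1 + a') * Real.log n))) ^ n - 1) +
      2 ^ n * Real.exp (-(κ * n * Real.log n)) ≤ (n : ℝ) ^ (-a) := by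
  have hlog2 : 0 < Real.log 2 := Real.log_pos one_lt_two
  filter_upwards [tendsto_log_nat.eventually_ge_atTop (Real.log 4 / (a' - a)),
    tendsto_log_nat.eventually_ge_atTop (4 * Real.log 2 / κ), eventually_ge_atTop 1,
    tendsto_natCast_atTop_atTop.eventually_ge_atTop (2 * a / κ)] with n h1 h2 h3 h4
  have hn : (0 : ℝ) < n := by exact_mod_cast h3
  have hn1 : (1 : ℝ) ≤ n := by exact_mod_cast h3
  rw [div_le_iff₀ (by linarith)] at h1
  rw [div_le_iff₀ hκ] at h2 h4
  have hL : 0 ≤ Real.log n := Real.log_natCast_nonneg n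
  set L := Real.log n with hLdef
  have hrpow : (n : ℝ) ^ (-a) = Real.exp (-(a * L)) := by
    rw [Real.rpow_def_of_pos hn, ← hLdef]; ring_nf
  have hnL : (n : ℝ) = Real.exp L := (Real.exp_log hn).symm
  have hhalf : Real.exp (-(a * L)) = Real.exp (-(a * L)) / 2 + Real.exp (-(a * L)) / 2 := by ring
  have hexp2 : Real.exp (-(a * L)) / 2 = Real.exp (-(a * L) - Real.log 2) := by
    rw [Real.exp_sub, Real.exp_log two_pos]
  rw [hrpow, hhalf]
  refine add_le_add ?_ ?_
  · have hz : n * Real.exp (-((1 + a') * L)) = Real.exp (-(a' * L)) := by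
      rw [hnL, ← Real.exp_add]; ring_nf
    have h5 : (1 + Real.exp (-((1 + a') * L))) ^ n ≤ Real.exp (Real.exp (-(a' * L))) := by
      rw [← hz, Real.exp_nat_mul]
      refine pow_le_pow_left₀ (by positivity) ?_ n
      linarith [Real.add_one_le_exp (Real.exp (-((1 + a') * L)))]
    have h6 : Real.exp (-(a' * L)) ≤ 1 := by
      rw [Real.exp_le_one_iff]
      nlinarith
    have h7 := Real.abs_exp_sub_one_le (x := Real.exp (-(a' * L))) (by
      rwa [abs_of_pos (Real.exp_pos _)])
    rw [abs_of_pos (Real.exp_pos (-(a' * L)))] at h7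
    have h8 := le_of_abs_le h7
    have h9 : 4 * Real.exp (-(a' * L)) ≤ Real.exp (-(a * L)) := by
      rw [← Real.exp_log (show (0 : ℝ) < 4 by norm_num), ← Real.exp_add]
      refine Real.exp_le_exp.2 ?_
      linarith
    linarith
  · rw [hexp2, ← Real.exp_log (show (0 : ℝ) < 2 by norm_num), ← Real.exp_nat_mul, ← Real.exp_add,
      Real.exp_log two_pos]
    refine Real.exp_le_exp.2 ?_
    nlinarith [mul_le_mul_of_nonneg_right h4 hL, mul_le_mul_of_nonneg_left h2 hn.le,
      mul_le_mul_of_nonneg_right hn1 hlog2.le]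

theorem exists_lt_one_lt_mul_pow {I c : ℝ} (h : c < I) (j : ℕ) :
    ∃ y : ℝ, 0 ≤ y ∧ y < 1 ∧ c < I * y ^ j := by
  have hc : Tendsto (fun y : ℝ => I * y ^ j) (𝓝[<] 1) (𝓝 (I * 1 ^ j)) :=
    ((continuous_const.mul (continuous_pow j)).tendsto 1).mono_left nhdsWithin_le_nhds
  rw [one_pow, mul_one] at hc
  have h0 : ∀ᶠ y : ℝ in 𝓝[<] 1, 0 < y := nhdsWithin_le_nhds (lt_mem_nhds one_pos)
  obtain ⟨y, h1, h2, h3⟩ := ((hc.eventually (lt_mem_nhds h)).and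
    (h0.and self_mem_nhdsWithin)).exists
  exact ⟨y, h2.le, h3, h1⟩

end UnionBound

/-! ### Exact recovery above the threshold -/

section Recovery

variable {k : ℕ} {α β : ℝ}

theorem eventually_failProb_le (hk : 2 ≤ k) (hα : 0 < α) (hβ : 0 < β)
    (hI : 1 < threshold k α β) :
    ∀ᶠ n : ℕ in evenAtTop, ∀ τ : Estimator n k, IsMLE (rate k α n) (rate k β n) τ →
      failProb (rate k α n) (rate k β n) τ ≤ (n : ℝ) ^ (-((threshold k α β - 1) / 2)) := by
  set I := threshold k α β with hIdef
  -- Any exponent strictly between `1 + (I - 1) / 2` and `I` leaves room for the constant factor.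
  obtain ⟨y, hy0, hy1, hy⟩ := exists_lt_one_lt_mul_pow
    (show 1 + 3 / 4 * (I - 1) < I by linarith) (k - 1)
  have hκ : 0 < I * (1 / 4) ^ (k - 1) * ((1 - y) / 4) :=
    mul_pos (by positivity) (by linarith)
  rw [evenAtTop, eventually_inf_principal]
  filter_upwards [eventually_sum_le_rpow (a := (I - 1) / 2) (a' := I * y ^ (k - 1) - 1)
      (by linarith) (by linarith) hκ, (tendsto_rate hk hα.le).eventually_le_const one_pos,
      (tendsto_rate hk hβ.le).eventually_le_const one_pos,
      eventually_ge_atTop (8 * k),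
      tendsto_natCast_atTop_atTop.eventually_ge_atTop (4 * (k - 1 : ℕ) / (1 - y))]
    with n hsum hp1 hq1 hn hny heven τ hτ
  obtain ⟨m, rfl⟩ : ∃ m, n = 2 * m := heven.two_dvd
  rw [div_le_iff₀ (by linarith)] at hny
  refine (failProb_le_of_isMLE hk rfl (rate_nonneg hα.le _) hp1 (rate_nonneg hβ.le _) hq1
    hτ).trans (le_trans ?_ hsum)
  refine le_trans (Finset.sum_le_sum fun S hS => ?_)
    (sum_pow_card_add_le (Real.exp_pos _).le (Real.exp_pos _).le (m := m))
  have := exp_neg_mul_choose_le (sq_nonneg _) (by linarith) (Real.log_natCast_nonneg (2 * m))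
    (sq_sub_sqrt_rate hα.le hβ.le (by omega)) hy0
    (Finset.mem_filter.1 hS).2.2 (by omega) (by push_cast at hny; linarith)
  simpa only [add_sub_cancel] using this

theorem failProb_nonneg {n : ℕ} {p q : ℝ} (hp0 : 0 ≤ p) (hp1 : p ≤ 1) (hq0 : 0 ≤ q) (hq1 : q ≤ 1)
    (τ : Estimator n k) : 0 ≤ failProb p q τ := by
  classical
  refine Finset.sum_nonneg fun σ _ => mul_nonneg (by positivity) (Finset.sum_nonneg fun H _ => ?_)
  split_ifs
  · exact likelihood_nonneg hp0 hp1 hq0 hq1 σ H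
  · exact le_rfl

theorem exactRecoveryPossible (hk : 2 ≤ k) (hα : 0 < α) (hβ : 0 < β)
    (hI : 1 < threshold k α β) : ExactRecoveryPossible k (rate k α) (rate k β) := by
  have hex : ∀ n : ℕ, ∃ τ : Estimator n k, Even n → IsMLE (rate k α n) (rate k β n) τ := fun n => by
    by_cases hn : Even n
    · obtain ⟨τ, hτ⟩ := exists_isMLE (k := k) hn (rate k α n) (rate k β n)
      exact ⟨τ, fun _ => hτ⟩
    · exact ⟨fun _ _ => 1, fun h => absurd h hn⟩
  choose τ hτ using hex
  refine ⟨τ, ?_⟩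
  have hle : evenAtTop ≤ atTop := inf_le_left
  have heven : ∀ᶠ n : ℕ in evenAtTop, Even n := by
    rw [evenAtTop, eventually_inf_principal]
    exact Eventually.of_forall fun n hn => hn
  have hlim : Tendsto (fun n : ℕ => (n : ℝ) ^ (-((threshold k α β - 1) / 2))) evenAtTop (𝓝 0) :=
    ((tendsto_rpow_neg_atTop (by linarith)).comp tendsto_natCast_atTop_atTop).mono_left hle
  refine squeeze_zero' ?_ ?_ hlim
  · filter_upwards [hle ((tendsto_rate hk hα.le).eventually_le_const one_pos),
      hle ((tendsto_rate hk hβ.le).eventually_le_const one_pos)] with n hp hq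
    exact failProb_nonneg (rate_nonneg hα.le _) hp (rate_nonneg hβ.le _) hq _
  · filter_upwards [eventually_failProb_le hk hα hβ hI, heven] with n h hn
    exact h _ (hτ n hn)

end Recovery

/-! ### Coincidence of two binomial variables -/

section Ties

/-- The mean of a binomial variable, not normalized. -/
theorem sum_mul_choose_mul_pow (s t : ℝ) (N : ℕ) :
    (s + t) * ∑ j ∈ Finset.range (N + 1), (j : ℝ) * (s ^ j * t ^ (N - j) * (N.choose j : ℝ)) =
      N * s * (s + t) ^ N := by
  cases N with
  | zero => simp
  | succ M =>
    rw [Finset.sum_range_succ']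
    have : ∀ j ∈ Finset.range (M + 1), ((j + 1 : ℕ) : ℝ) *
        (s ^ (j + 1) * t ^ (M + 1 - (j + 1)) * ((M + 1).choose (j + 1) : ℝ)) =
        (M + 1 : ℕ) * s * (s ^ j * t ^ (M - j) * (M.choose j : ℝ)) := by
      intro j _
      have h : ((M + 1 : ℕ) : ℝ) * (M.choose j : ℝ) =
          ((M + 1).choose (j + 1) : ℝ) * ((j + 1 : ℕ) : ℝ) := by
        exact_mod_cast Nat.add_one_mul_choose_eq M j
      rw [Nat.add_sub_add_right, pow_succ]
      linear_combination (-(s ^ j * s * t ^ (M - j))) * h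
    rw [Finset.sum_congr rfl this, ← Finset.mul_sum, ← add_pow]
    simp
    ring

/-- Two independent copies of a binomial variable with mean at most `(J + 1) / 2` coincide with
probability at least `1 / (4 (J + 1))`; here the law is not normalized. -/
theorem le_sum_sq_binomial {s t : ℝ} (hs : 0 ≤ s) (ht : 0 < t) {N J : ℕ}
    (hJ : 2 * (N * s) ≤ (J + 1) * (s + t)) :
    ((s + t) ^ N) ^ 2 / (4 * (J + 1)) ≤
      ∑ j ∈ Finset.range (N + 1), (s ^ j * t ^ (N - j) * (N.choose j : ℝ)) ^ 2 := by
  set c : ℕ → ℝ := fun j => s ^ j * t ^ (N - j) * (N.choose j : ℝ) with hc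
  have hc0 : ∀ j, 0 ≤ c j := fun j => by positivity
  have hst : 0 < s + t := by linarith
  have hJ1 : (0 : ℝ) < J + 1 := by positivity
  have h1 : ∑ j ∈ Finset.range (N + 1), c j = (s + t) ^ N := (add_pow s t N).symm
  have h2 := sum_mul_choose_mul_pow s t N
  have h3 := Finset.sum_filter_add_sum_filter_not (Finset.range (N + 1)) (fun j => j ≤ J) c
  have h4 : (J + 1) * ∑ j ∈ Finset.range (N + 1) with ¬ j ≤ J, c j ≤
      ∑ j ∈ Finset.range (N + 1), (j : ℝ) * c j := by
    rw [Finset.mul_sum]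
    refine le_trans (Finset.sum_le_sum fun j hj => ?_) (Finset.sum_le_sum_of_subset_of_nonneg
      (Finset.filter_subset _ _) fun j _ _ => mul_nonneg (Nat.cast_nonneg j) (hc0 j))
    have : J + 1 ≤ j := by
      have := (Finset.mem_filter.1 hj).2
      omega
    have : ((J + 1 : ℕ) : ℝ) ≤ j := by exact_mod_cast this
    push_cast at this
    exact mul_le_mul_of_nonneg_right this (hc0 j)
  have h5 : ∑ j ∈ Finset.range (N + 1) with ¬ j ≤ J, c j ≤ (s + t) ^ N / 2 := by
    refine le_of_mul_le_mul_left ?_ (mul_pos hJ1 hst)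
    have h6 := mul_le_mul_of_nonneg_left h4 hst.le
    have h7 := mul_le_mul_of_nonneg_right hJ (pow_nonneg hst.le N)
    rw [h2] at h6
    linarith
  have h8 : (s + t) ^ N / 2 ≤ ∑ j ∈ Finset.range (N + 1) with j ≤ J, c j := by linarith
  have h9 := sq_sum_le_card_mul_sum_sq
    (s := (Finset.range (N + 1)).filter (fun j => j ≤ J)) (f := c)
  have hcard : ((Finset.range (N + 1)).filter (fun j => j ≤ J)).card ≤ J + 1 := by
    have : (Finset.range (N + 1)).filter (fun j => j ≤ J) ⊆ Finset.range (J + 1) := by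
      intro j hj
      have := (Finset.mem_filter.1 hj).2
      simp
      omega
    simpa using Finset.card_le_card this
  have hcard' : (((Finset.range (N + 1)).filter (fun j => j ≤ J)).card : ℝ) ≤ J + 1 := by
    exact_mod_cast hcard
  have h10 : ∑ j ∈ Finset.range (N + 1) with j ≤ J, c j ^ 2 ≤
      ∑ j ∈ Finset.range (N + 1), c j ^ 2 :=
    Finset.sum_le_sum_of_subset_of_nonneg (Finset.filter_subset _ _) fun j _ _ => sq_nonneg _
  rw [div_le_iff₀ (by positivity)]
  have h11 : ((s + t) ^ N / 2) ^ 2 ≤ (∑ j ∈ Finset.range (N + 1) with j ≤ J, c j) ^ 2 :=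
    pow_le_pow_left₀ (by positivity) h8 2
  have h12 : (((Finset.range (N + 1)).filter (fun j => j ≤ J)).card : ℝ) *
      ∑ j ∈ Finset.range (N + 1) with j ≤ J, c j ^ 2 ≤
      (J + 1) * ∑ j ∈ Finset.range (N + 1), c j ^ 2 :=
    mul_le_mul hcard' h10 (Finset.sum_nonneg fun _ _ => sq_nonneg _) hJ1.le
  linarith

/-- The converse of `affinity_le`, up to a second-order error. -/
theorem exp_le_affinity {p q : ℝ} (hp : 0 ≤ p) (hq : 0 ≤ q) (hpq : p + q ≤ 1 / 4) :
    Real.exp (-((√p - √q) ^ 2 / 2 + 3 * (p + q) ^ 2)) ≤ √(p * q) + √((1 - p) * (1 - q)) := by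
  have h1 : 1 - (p + q) / 2 - (p + q) ^ 2 ≤ √((1 - p) * (1 - q)) := by
    refine Real.le_sqrt_of_sq_le ?_
    have h0 : 0 ≤ p + q := by linarith
    have : (p + q) ^ 3 ≤ (p + q) ^ 2 * (1 / 4) := by
      rw [pow_succ]; exact mul_le_mul_of_nonneg_left hpq (sq_nonneg _)
    have : (p + q) ^ 4 ≤ (p + q) ^ 2 * (1 / 16) := by
      have : (p + q) ^ 2 ≤ 1 / 16 := by nlinarith
      calc (p + q) ^ 4 = (p + q) ^ 2 * (p + q) ^ 2 := by ring
        _ ≤ _ := mul_le_mul_of_nonneg_left this (sq_nonneg _)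
    nlinarith [mul_nonneg hp hq, sq_nonneg (p + q)]
  have h3 : (√p - √q) ^ 2 = p + q - 2 * √(p * q) := by
    rw [Real.sqrt_mul hp, sub_sq, Real.sq_sqrt hp, Real.sq_sqrt hq]
    ring
  have h4 := Real.sqrt_nonneg (p * q)
  set y := (√p - √q) ^ 2 / 2 + (p + q) ^ 2 with hy
  have hy0 : 0 ≤ y := by positivity
  have hyle : y ≤ p + q := by
    rw [hy, h3]
    nlinarith
  have hρ : 1 - y ≤ √(p * q) + √((1 - p) * (1 - q)) := by rw [hy, h3]; linarith
  have hy2 : y ^ 2 ≤ (p + q) ^ 2 := pow_le_pow_left₀ hy0 hyle 2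
  have h1y : 0 < 1 - y := by linarith
  refine le_trans ?_ hρ
  rw [← Real.exp_log h1y]
  refine Real.exp_le_exp.2 (le_trans ?_ (Real.one_sub_inv_le_log_of_pos h1y))
  have h6 : (1 - y)⁻¹ ≤ 1 + y + 2 * y ^ 2 := by
    rw [inv_le_iff_one_le_mul₀ h1y]
    nlinarith [sq_nonneg y]
  linarith

variable {ι : Type*} [DecidableEq ι] [Fintype ι]

theorem expect_card_inter_eq_card_inter {r : ι → ℝ} {A B : Finset ι} (hAB : Disjoint A B)
    {p q : ℝ} (hA : ∀ e ∈ A, r e = p) (hB : ∀ e ∈ B, r e = q) {N : ℕ} (hAN : A.card = N)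
    (hBN : B.card = N) (hpq : 0 ≤ p * q) (hpq' : 0 ≤ (1 - p) * (1 - q)) :
    expect r (fun H => if (H ∩ A).card = (H ∩ B).card then 1 else 0) =
      ∑ j ∈ Finset.range (N + 1),
        (√(p * q) ^ j * √((1 - p) * (1 - q)) ^ (N - j) * (N.choose j : ℝ)) ^ 2 := by
  have h : ∀ H : Finset ι, (if (H ∩ A).card = (H ∩ B).card then (1 : ℝ) else 0) =
      ∑ j ∈ Finset.range (N + 1),
        (if (H ∩ A).card = j then (1 : ℝ) else 0) * (if (H ∩ B).card = j then (1 : ℝ) else 0) := by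
    intro H
    have hle : (H ∩ A).card < N + 1 := by
      have := Finset.card_le_card (Finset.inter_subset_right (s₁ := H) (s₂ := A))
      omega
    simp only [ite_mul, one_mul, zero_mul]
    rw [Finset.sum_ite_eq, if_pos (Finset.mem_range.2 hle)]
    simp only [eq_comm]
  simp only [h]
  rw [expect_sum]
  refine Finset.sum_congr rfl fun j _ => ?_
  rw [expect_mul_of_disjoint r hAB (fun S => if S.card = j then (1 : ℝ) else 0)
    (fun S => if S.card = j then (1 : ℝ) else 0), expect_card_inter hA, expect_card_inter hB, hAN,
    hBN]
  have h1 : (√(p * q) ^ j) ^ 2 = (p * q) ^ j := by 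
    rw [← pow_mul, mul_comm j, pow_mul, Real.sq_sqrt hpq]
  have h2 : (√((1 - p) * (1 - q)) ^ (N - j)) ^ 2 = ((1 - p) * (1 - q)) ^ (N - j) := by
    rw [← pow_mul, mul_comm (N - j), pow_mul, Real.sq_sqrt hpq']
  rw [mul_pow, mul_pow, h1, h2, mul_pow, mul_pow]
  ring

end Ties

/-! ### The second moment method -/

section SecondMoment

variable {ι κ : Type*} [DecidableEq ι] [Fintype ι]

/-- Chebyshev and Markov: if the indicators `f u` are pairwise independent with mean `π` and
`f u * g u` has mean at most `η * π`, then with probability `1 - 4 / E - 4 * η`, where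
`E = |W| * π`, at least `E / 4` of the `u` have `f u = 1` and `g u = 0`. -/
theorem expect_sum_lt_le [DecidableEq κ] {r : ι → ℝ} (h0 : ∀ e, 0 ≤ r e) (h1 : ∀ e, r e ≤ 1)
    {W : Finset κ} {f g : κ → Finset ι → ℝ} {π η : ℝ}
    (hf : ∀ u ∈ W, ∀ H, f u H = 0 ∨ f u H = 1) (hg : ∀ u ∈ W, ∀ H, 0 ≤ g u H)
    (hE : 0 < W.card * π)
    (hmean : ∀ u ∈ W, expect r (f u) = π)
    (hpair : ∀ u ∈ W, ∀ v ∈ W, u ≠ v → expect r (fun H => f u H * f v H) = π * π)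
    (hfg : ∀ u ∈ W, expect r (fun H => f u H * g u H) ≤ η * π) {B : Finset ι → Prop}
    [DecidablePred B]
    (hB : ∀ H, B H → ∑ u ∈ W, f u H * (1 - g u H) < W.card * π / 4) :
    expect r (fun H => if B H then 1 else 0) ≤ 4 / (W.card * π) + 4 * η := by
  set E := W.card * π with hEdef
  have hπ : 0 < π := by
    by_contra h
    have := mul_nonpos_of_nonneg_of_nonpos (Nat.cast_nonneg (α := ℝ) W.card) (not_lt.1 h)
    linarith
  -- Let `X = ∑ f` and `Y = ∑ f * g`. On `B`, either `X < E / 2` or `Y > E / 4`, so the indicator of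
  -- `B` is at most `4 * (X / E - 1) ^ 2 + 4 * Y / E`.
  have hpt : ∀ H : Finset ι, (if B H then (1 : ℝ) else 0) ≤
      (4 / E ^ 2) * (∑ u ∈ W, ∑ v ∈ W, f u H * f v H) + (-(8 / E)) * (∑ u ∈ W, f u H) + 4 * 1 +
        (4 / E) * ∑ u ∈ W, f u H * g u H := by
    intro H
    have hS : (4 / E ^ 2) * (∑ u ∈ W, ∑ v ∈ W, f u H * f v H) +
        (-(8 / E)) * (∑ u ∈ W, f u H) + 4 * 1 = 4 * ((∑ u ∈ W, f u H) / E - 1) ^ 2 := by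
      rw [← Finset.sum_mul_sum]
      field_simp
      ring
    rw [hS]
    have hY : 0 ≤ ∑ u ∈ W, f u H * g u H := Finset.sum_nonneg fun u hu => by
      refine mul_nonneg ?_ (hg u hu H)
      rcases hf u hu H with h | h <;> rw [h]
      exact zero_le_one
    split_ifs with hBH
    · have h2 := hB H hBH
      simp only [mul_sub, mul_one] at h2
      rw [Finset.sum_sub_distrib] at h2
      set X := ∑ u ∈ W, f u H
      set Y := ∑ u ∈ W, f u H * g u H
      rcases le_total Y (E / 4) with h3 | h3
      · have h4 : X / E ≤ 1 / 2 := by rw [div_le_iff₀ hE]; linarith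
        have h5 : 0 ≤ 4 / E * Y := by positivity
        nlinarith
      · have h4 : 1 ≤ 4 / E * Y := by
          rw [div_mul_eq_mul_div, le_div_iff₀ hE]; linarith
        linarith [sq_nonneg (X / E - 1)]
    · positivity
  refine (expect_mono h0 h1 hpt).trans ?_
  rw [expect_add, expect_add, expect_add, expect_const_mul, expect_const_mul, expect_const_mul,
    expect_const_mul, expect_one, expect_sum, expect_sum, expect_sum, Finset.sum_congr rfl hmean,
    Finset.sum_const, nsmul_eq_mul, ← hEdef]
  have h2 : ∑ u ∈ W, expect r (fun H => ∑ v ∈ W, f u H * f v H) ≤ E + E ^ 2 := by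
    have : ∀ u ∈ W, expect r (fun H => ∑ v ∈ W, f u H * f v H) ≤ π + E * π := by
      intro u hu
      rw [expect_sum, ← Finset.add_sum_erase _ _ hu]
      refine add_le_add ?_ ?_
      · rw [← hmean u hu]
        refine le_of_eq (congrArg _ (funext fun H => ?_))
        rcases hf u hu H with h | h <;> rw [h] <;> norm_num
      · rw [Finset.sum_congr rfl fun v hv => hpair u hu v (Finset.mem_of_mem_erase hv)
          (Finset.ne_of_mem_erase hv).symm, Finset.sum_const, nsmul_eq_mul, hEdef, mul_assoc]
        refine mul_le_mul_of_nonneg_right ?_ (by positivity)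
        exact_mod_cast Finset.card_erase_le
    refine (Finset.sum_le_sum this).trans (le_of_eq ?_)
    rw [Finset.sum_const, nsmul_eq_mul, hEdef]
    ring
  have h3 : ∑ u ∈ W, expect r (fun H => f u H * g u H) ≤ η * E := by
    refine (Finset.sum_le_sum hfg).trans (le_of_eq ?_)
    rw [Finset.sum_const, nsmul_eq_mul, hEdef]
    ring
  have h4 := mul_le_mul_of_nonneg_left h2 (show 0 ≤ 4 / E ^ 2 by positivity)
  have h5 := mul_le_mul_of_nonneg_left h3 (show 0 ≤ 4 / E by positivity)
  have h6 : 4 / E ^ 2 * (E + E ^ 2) = 4 / E + 4 := by field_simp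
  have h7 : 4 / E * (η * E) = 4 * η := by field_simp
  have h8 : -(8 / E) * E = -8 := by field_simp
  rw [h8]
  linarith

theorem expect_nonempty_inter_le {r : ι → ℝ} (h0 : ∀ e, 0 ≤ r e) (h1 : ∀ e, r e ≤ 1) {c : ℝ}
    {C : Finset ι} (hc : ∀ e ∈ C, r e ≤ c) :
    expect r (fun H => if (H ∩ C).Nonempty then 1 else 0) ≤ C.card * c := by
  have hpt : ∀ H : Finset ι, (if (H ∩ C).Nonempty then (1 : ℝ) else 0) ≤
      ∑ e ∈ C, if e ∈ H then 1 else 0 := by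
    intro H
    split_ifs with h
    · obtain ⟨e, he⟩ := h
      rw [Finset.mem_inter] at he
      refine le_trans ?_ (Finset.single_le_sum (f := fun e => if e ∈ H then (1 : ℝ) else 0)
        (fun e _ => by positivity) he.2)
      rw [if_pos he.1]
    · positivity
  refine (expect_mono h0 h1 hpt).trans ?_
  rw [expect_sum, Finset.sum_congr rfl fun e _ => expect_mem r e]
  refine (Finset.sum_le_card_nsmul C r c hc).trans (le_of_eq (nsmul_eq_mul _ _))

end SecondMoment

/-! ### Ambiguous hypergraphs defeat every estimator -/

section EstimatorBound

variable {n k : ℕ} {p q : ℝ}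

open scoped Classical in
/-- If most of the mass sits on hypergraphs that at least `K` balanced labelings explain equally
well as the true one, then every estimator fails with probability about `1 - 2 / K`. -/
theorem one_sub_le_failProb (hn : Even n) (hp0 : 0 ≤ p) (hp1 : p ≤ 1) (hq0 : 0 ≤ q) (hq1 : q ≤ 1)
    {K : ℕ} (hK : 0 < K) {c : ℝ}
    (h : ∀ σ, Balanced σ → ∑ H : Hypergraph n k,
      (if ((balanced n).filter fun x => likelihood p q x H = likelihood p q σ H).card < K
        then likelihood p q σ H else 0) ≤ c) (τ : Estimator n k) :
    1 - (2 / K + c) ≤ failProb p q τ := by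
  have hL := fun x : Labeling n => likelihood_nonneg (k := k) hp0 hp1 hq0 hq1 x
  have hM : (0 : ℝ) < (balanced n).card := by exact_mod_cast (balanced_nonempty hn).card_pos
  have hK' : (0 : ℝ) < K := by exact_mod_cast hK
  set G : Labeling n → Hypergraph n k → ℝ := fun σ H => if τ H = σ ∨ τ H = -σ then 1 else 0
  set T : Hypergraph n k → ℝ := fun H => ∑ x ∈ balanced n, likelihood p q x H
  have hsucc : ∑ σ ∈ balanced n, ∑ H : Hypergraph n k, G σ H * likelihood p q σ H ≤
      (balanced n).card * (2 / K + c) := by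
    -- If at least `K` labelings tie with `σ`, then `σ` has at most a share `1 / K` of `T H`.
    have hpt : ∀ σ ∈ balanced n, ∀ H : Hypergraph n k, G σ H * likelihood p q σ H ≤
        (if ((balanced n).filter fun x => likelihood p q x H = likelihood p q σ H).card < K
          then likelihood p q σ H else 0) + G σ H * (T H / K) := by
      intro σ _ H
      have hT : 0 ≤ T H := Finset.sum_nonneg fun x _ => hL x H
      have hG : 0 ≤ G σ H ∧ G σ H ≤ 1 := by
        simp only [G]
        split_ifs <;> norm_num
      split_ifs with hlt
      · have h1 := mul_le_of_le_one_left (hL σ H) hG.2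
        have h2 : 0 ≤ G σ H * (T H / K) := mul_nonneg hG.1 (by positivity)
        linarith
      · rw [zero_add]
        refine mul_le_mul_of_nonneg_left ?_ hG.1
        rw [le_div_iff₀ hK']
        have h1 : ((K : ℕ) : ℝ) ≤
          ((balanced n).filter fun x => likelihood p q x H = likelihood p q σ H).card := by
          exact_mod_cast not_lt.1 hlt
        calc likelihood p q σ H * K ≤ likelihood p q σ H * ((balanced n).filter fun x =>
              likelihood p q x H = likelihood p q σ H).card :=
              mul_le_mul_of_nonneg_left h1 (hL σ H)
          _ = ∑ x ∈ (balanced n).filter fun x => likelihood p q x H = likelihood p q σ H,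
              likelihood p q x H := by
              rw [Finset.sum_congr rfl fun x hx => (Finset.mem_filter.1 hx).2, Finset.sum_const,
                nsmul_eq_mul, mul_comm]
          _ ≤ T H := Finset.sum_le_sum_of_subset_of_nonneg (Finset.filter_subset _ _)
              fun x _ _ => hL x H
    have h2 : ∀ H : Hypergraph n k, ∑ σ ∈ balanced n, G σ H ≤ 2 := by
      intro H
      simp only [G]
      rw [← Finset.sum_filter, Finset.sum_const, nsmul_eq_mul, mul_one]
      have : (balanced n).filter (fun σ => τ H = σ ∨ τ H = -σ) ⊆ {τ H, -τ H} := by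
        intro σ hσ
        rcases (Finset.mem_filter.1 hσ).2 with h | h <;> simp [h]
      exact_mod_cast (Finset.card_le_card this).trans Finset.card_le_two
    calc _ ≤ ∑ σ ∈ balanced n, (c + ∑ H : Hypergraph n k, G σ H * (T H / K)) := by
          refine Finset.sum_le_sum fun σ hσ => ?_
          refine (Finset.sum_le_sum fun H _ => hpt σ hσ H).trans ?_
          rw [Finset.sum_add_distrib]
          exact add_le_add (h σ (mem_balanced.1 hσ)) le_rfl
      _ = (balanced n).card * c + ∑ H : Hypergraph n k, (∑ σ ∈ balanced n, G σ H) * (T H / K) := by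
          rw [Finset.sum_add_distrib, Finset.sum_const, nsmul_eq_mul, Finset.sum_comm]
          simp only [Finset.sum_mul]
      _ ≤ (balanced n).card * c + ∑ H : Hypergraph n k, 2 * (T H / K) := by
          refine add_le_add le_rfl (Finset.sum_le_sum fun H _ => ?_)
          exact mul_le_mul_of_nonneg_right (h2 H)
            (div_nonneg (Finset.sum_nonneg fun x _ => hL x H) hK'.le)
      _ = (balanced n).card * (2 / K + c) := by
          rw [← Finset.mul_sum, ← Finset.sum_div, Finset.sum_comm]
          simp only [sum_likelihood, Finset.sum_const, nsmul_eq_mul, mul_one]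
          ring
  have hsplit : failProb p q τ = 1 - (1 / ((balanced n).card : ℝ)) *
      ∑ σ ∈ balanced n, ∑ H : Hypergraph n k, G σ H * likelihood p q σ H := by
    have h1 : ∀ σ : Labeling n, ∑ H : Hypergraph n k,
        (if ¬ (τ H = σ ∨ τ H = -σ) then likelihood p q σ H else 0) =
        1 - ∑ H : Hypergraph n k, G σ H * likelihood p q σ H := by
      intro σ
      rw [← sum_likelihood (k := k) p q σ, ← Finset.sum_sub_distrib]
      refine Finset.sum_congr rfl fun H _ => ?_
      simp only [G]
      by_cases h : τ H = σ ∨ τ H = -σ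
      · rw [if_neg (not_not.2 h), if_pos h]; ring
      · rw [if_pos h, if_neg h]; ring
    unfold failProb prob
    rw [← Finset.mul_sum]
    have h2 := Finset.sum_congr (rfl : balanced n = balanced n) fun σ _ => h1 σ
    rw [Finset.sum_sub_distrib, Finset.sum_const, nsmul_eq_mul, mul_one] at h2
    calc _ = (1 / ((balanced n).card : ℝ)) * ∑ σ ∈ balanced n, ∑ H : Hypergraph n k,
          (if ¬ (τ H = σ ∨ τ H = -σ) then likelihood p q σ H else 0) := by
          congr! 5
      _ = _ := by
          rw [h2, mul_sub, one_div, inv_mul_cancel₀ hM.ne']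
  rw [hsplit, one_div]
  have := mul_le_mul_of_nonneg_left hsucc (inv_nonneg.2 hM.le)
  rw [inv_mul_cancel_left₀ hM.ne'] at this
  linarith

end EstimatorBound

/-! ### Exchanging two labels -/

section Swap

variable {n k : ℕ} {p q : ℝ}

open scoped Classical in
/-- The `k`-subsets that are in-cluster with respect to `σ`. -/
noncomputable def inClusterSets (k : ℕ) (σ : Labeling n) : Finset (KSubset n k) :=
  Finset.univ.filter fun e => InCluster σ e

theorem mem_inClusterSets {σ : Labeling n} {e : KSubset n k} :
    e ∈ inClusterSets k σ ↔ InCluster σ e := by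
  simp [inClusterSets]

/-- The likelihood depends on the labeling only through the numbers of in-cluster sets and of
in-cluster hyperedges. -/
theorem likelihood_eq_of_card_eq {σ x : Labeling n} {H : Hypergraph n k}
    (h1 : (inClusterSets k σ).card = (inClusterSets k x).card)
    (h2 : (H ∩ inClusterSets k σ).card = (H ∩ inClusterSets k x).card) :
    likelihood p q σ H = likelihood p q x H := by
  classical
  have h : ∀ σ : Labeling n, likelihood p q σ H =
      p ^ (H ∩ inClusterSets k σ).card * q ^ (H.card - (H ∩ inClusterSets k σ).card) *
      ((1 - p) ^ ((inClusterSets k σ).card - (H ∩ inClusterSets k σ).card) *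
        (1 - q) ^ (Hᶜ.card - ((inClusterSets k σ).card - (H ∩ inClusterSets k σ).card))) := by
    intro σ
    have e1 : (H.filter fun e => InCluster σ e) = H ∩ inClusterSets k σ := by
      ext e; simp [mem_inClusterSets]
    have e2 : (Hᶜ.filter fun e => InCluster σ e) = inClusterSets k σ \ H := by
      ext e; simp [mem_inClusterSets, and_comm]
    have c1 := Finset.card_filter_add_card_filter_not (s := H) (fun e => InCluster σ e)
    have c2 := Finset.card_filter_add_card_filter_not (s := Hᶜ) (fun e => InCluster σ e)
    have c3 := Finset.card_sdiff_add_card_inter (inClusterSets k σ) H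
    rw [Finset.inter_comm] at c3
    rw [e1] at c1
    rw [e2] at c2
    rw [likelihood_eq_bernWeight, bernWeight_of_subset (Finset.subset_univ _),
      ← Finset.compl_eq_univ_sdiff]
    unfold edgeProb
    congr 1
    · rw [Finset.prod_ite, Finset.prod_const, Finset.prod_const, e1]
      congr 2
      omega
    · simp only [apply_ite (fun t : ℝ => 1 - t)]
      rw [Finset.prod_ite, Finset.prod_const, Finset.prod_const, e2]
      congr 2
      · omega
      · omega
  rw [h σ, h x, h1, h2]

/-- The labeling in which `u` and `v` have exchanged their labels. -/
def swapLabels (σ : Labeling n) (u v : Fin n) : Labeling n := fun w => σ (Equiv.swap u v w)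

theorem swapLabels_left (σ : Labeling n) (u v : Fin n) : swapLabels σ u v u = σ v := by
  simp [swapLabels]

theorem swapLabels_right (σ : Labeling n) (u v : Fin n) : swapLabels σ u v v = σ u := by
  simp [swapLabels]

theorem swapLabels_of_ne {σ : Labeling n} {u v w : Fin n} (hu : w ≠ u) (hv : w ≠ v) :
    swapLabels σ u v w = σ w := by
  simp [swapLabels, Equiv.swap_apply_of_ne_of_ne hu hv]

theorem swapLabels_swapLabels (σ : Labeling n) (u v : Fin n) :
    swapLabels (swapLabels σ u v) u v = σ := by
  funext w
  simp [swapLabels]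

theorem Balanced.swapLabels {σ : Labeling n} (h : Balanced σ) (u v : Fin n) :
    Balanced (swapLabels σ u v) := by
  have : ∑ w, (σ (Equiv.swap u v w) : ℤ) = ∑ w, (σ w : ℤ) :=
    Equiv.sum_comp (Equiv.swap u v) fun w => (σ w : ℤ)
  exact this.trans h

theorem card_inClusterSets_swapLabels (σ : Labeling n) (u v : Fin n) :
    (inClusterSets k (swapLabels σ u v)).card = (inClusterSets k σ).card := by
  let π : KSubset n k → KSubset n k := fun e =>
    ⟨e.1.map (Equiv.swap u v).toEmbedding, by rw [Finset.card_map, e.2]⟩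
  have hππ : ∀ e, π (π e) = e := fun e => by
    refine Subtype.ext ?_
    ext w
    simp [π]
  have hπ : ∀ (σ : Labeling n) (e : KSubset n k), InCluster (swapLabels σ u v) e →
      InCluster σ (π e) := by
    intro σ e h a ha b hb
    obtain ⟨a', ha', rfl⟩ := Finset.mem_map.1 ha
    obtain ⟨b', hb', rfl⟩ := Finset.mem_map.1 hb
    exact h a' ha' b' hb'
  refine Finset.card_nbij' π π (fun e he => ?_) (fun e he => ?_) (fun e _ => hππ e)
    fun e _ => hππ e
  · exact mem_inClusterSets.2 (hπ σ e (mem_inClusterSets.1 he))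
  · refine mem_inClusterSets.2 (hπ (swapLabels σ u v) e ?_)
    rw [swapLabels_swapLabels]
    exact mem_inClusterSets.1 he

/-- When no hyperedge through `u` or `v` meets `U` in a further vertex, the hyperedges that stop
being in-cluster when `u` and `v` exchange labels are those joining `u` or `v` to vertices of its
own cluster outside `U`. -/
theorem card_inter_inClusterSets_sdiff (hk : 2 ≤ k) {σ : Labeling n} {U : Finset (Fin n)}
    {u v : Fin n} (hu : u ∈ U) (hv : v ∈ U) (huv : σ u ≠ σ v) {H : Hypergraph n k}
    (hHu : H ∩ touching k u U = ∅) (hHv : H ∩ touching k v U = ∅) :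
    ((H ∩ inClusterSets k σ) \ (H ∩ inClusterSets k (swapLabels σ u v))).card =
      (H ∩ star k u (cluster σ (σ u) \ U)).card + (H ∩ star k v (cluster σ (σ v) \ U)).card := by
  have hne : u ≠ v := fun h => huv (by rw [h])
  have hclean : ∀ a, H ∩ touching k a U = ∅ → ∀ e ∈ H, a ∈ e.1 → ∀ w ∈ e.1, w ≠ a → w ∉ U := by
    intro a ha e he hae w hw hwa hwU
    have : e ∈ H ∩ touching k a U := Finset.mem_inter.2 ⟨he, mem_touching.2 ⟨hae, w, hw, hwa, hwU⟩⟩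
    rw [ha] at this
    exact absurd this (Finset.notMem_empty e)
  rw [← Finset.card_union_of_disjoint]
  · congr 1
    ext e
    simp only [Finset.mem_sdiff, Finset.mem_inter, Finset.mem_union, mem_inClusterSets, mem_star,
      mem_cluster]
    constructor
    · rintro ⟨⟨he, hin⟩, hout⟩
      have hmem : u ∈ e.1 ∨ v ∈ e.1 := by
        by_contra hcon
        rw [not_or] at hcon
        refine hout ⟨he, fun a ha b hb => ?_⟩
        have : ∀ a ∈ e.1, swapLabels σ u v a = σ a := fun a ha =>
          swapLabels_of_ne (fun h => hcon.1 (h ▸ ha)) (fun h => hcon.2 (h ▸ ha))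
        rw [this a ha, this b hb]
        exact hin a ha b hb
      rcases hmem with h | h
      · exact Or.inl ⟨he, h, fun w hw hwu => ⟨hin w hw u h, hclean u hHu e he h w hw hwu⟩⟩
      · exact Or.inr ⟨he, h, fun w hw hwv => ⟨hin w hw v h, hclean v hHv e he h w hw hwv⟩⟩
    · have main : ∀ a b, a ∈ U → b ∈ U → σ a ≠ σ b → swapLabels σ u v a = σ b →
          (∀ w, w ≠ a → w ≠ b → swapLabels σ u v w = σ w) →
          (e ∈ H ∧ a ∈ e.1 ∧ ∀ w ∈ e.1, w ≠ a → σ w = σ a ∧ w ∉ U) →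
          (e ∈ H ∧ InCluster σ e) ∧ ¬ (e ∈ H ∧ InCluster (swapLabels σ u v) e) := by
        rintro a b haU hbU hab hxa hxw ⟨he, hae, hw⟩
        have hall : ∀ w ∈ e.1, σ w = σ a := fun w hwe => by
          by_cases h : w = a
          · rw [h]
          · exact (hw w hwe h).1
        refine ⟨⟨he, fun c hc d hd => (hall c hc).trans (hall d hd).symm⟩, fun hcon => hab ?_⟩
        obtain ⟨w, hwe, hwa⟩ := exists_ne_of_mem hk e a
        have h1 := hw w hwe hwa
        have h2 : w ≠ b := fun h => h1.2 (h ▸ hbU)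
        rw [← hxa, hcon.2 a hae w hwe, hxw w hwa h2, h1.1]
      rintro (h | h)
      · exact main u v hu hv huv (swapLabels_left σ u v) (fun w h1 h2 => swapLabels_of_ne h1 h2) h
      · exact main v u hv hu huv.symm (swapLabels_right σ u v)
          (fun w h1 h2 => swapLabels_of_ne h2 h1) h
  · refine Finset.disjoint_left.2 fun e h1 h2 => ?_
    simp only [Finset.mem_inter, mem_star, Finset.mem_sdiff] at h1 h2
    exact (h1.2.2 v h2.2.1 hne.symm).2 hv

/-- The sets that become in-cluster are found by exchanging the roles of the two labelings.
Exchanging the labels of two vertices of opposite clusters, each with as many hyperedges into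
its own cluster as into the other one, does not change the likelihood. -/
theorem likelihood_swapLabels (hk : 2 ≤ k) {σ : Labeling n} {U : Finset (Fin n)}
    {u v : Fin n} (hu : u ∈ U) (hv : v ∈ U) (huv : σ u ≠ σ v) {H : Hypergraph n k}
    (hHu : H ∩ touching k u U = ∅) (hHv : H ∩ touching k v U = ∅)
    (htu : (H ∩ star k u (cluster σ (σ u) \ U)).card = (H ∩ star k u (cluster σ (-σ u) \ U)).card)
    (htv : (H ∩ star k v (cluster σ (σ v) \ U)).card =
      (H ∩ star k v (cluster σ (-σ v) \ U)).card) :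
    likelihood p q (swapLabels σ u v) H = likelihood p q σ H := by
  refine likelihood_eq_of_card_eq (card_inClusterSets_swapLabels σ u v) ?_
  have h1 := card_inter_inClusterSets_sdiff hk hu hv huv hHu hHv
  have huv' : swapLabels σ u v u ≠ swapLabels σ u v v := by
    rw [swapLabels_left, swapLabels_right]
    exact huv.symm
  have h2 := card_inter_inClusterSets_sdiff hk hu hv huv' hHu hHv
  have hcl : ∀ s, cluster (swapLabels σ u v) s \ U = cluster σ s \ U := by
    intro s
    ext w
    simp only [Finset.mem_sdiff, mem_cluster]
    refine and_congr_left fun hw => ?_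
    rw [swapLabels_of_ne (fun h : w = u => hw (h ▸ hu)) (fun h : w = v => hw (h ▸ hv))]
  rw [swapLabels_swapLabels, swapLabels_left, swapLabels_right, hcl, hcl] at h2
  rw [← eq_neg_of_ne huv.symm] at htu
  rw [← eq_neg_of_ne huv] at htv
  have h3 := Finset.card_sdiff_add_card_inter (H ∩ inClusterSets k σ)
    (H ∩ inClusterSets k (swapLabels σ u v))
  have h4 := Finset.card_sdiff_add_card_inter (H ∩ inClusterSets k (swapLabels σ u v))
    (H ∩ inClusterSets k σ)
  rw [Finset.inter_comm (H ∩ inClusterSets k (swapLabels σ u v))] at h4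
  omega

theorem swapLabels_injOn {σ : Labeling n} {v : Fin n} :
    Set.InjOn (fun u => swapLabels σ u v) {u | σ u ≠ σ v} := by
  intro u hu u' hu' h
  by_contra hne
  have h1 := congrFun h u
  simp only at h1
  rw [swapLabels_left, swapLabels_of_ne hne fun h => hu (by rw [h])] at h1
  exact hu h1.symm

end Swap

/-! ### The probability of a tie -/

section TieProbability

/-- The probability that independent binomial variables with parameters `(N, p)` and `(N, q)`
coincide, for `p, q ∈ [0, 1]`. -/
noncomputable def tieProb (p q : ℝ) (N : ℕ) : ℝ :=
  ∑ j ∈ Finset.range (N + 1), (√(p * q) ^ j * √((1 - p) * (1 - q)) ^ (N - j) * (N.choose j : ℝ)) ^ 2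

theorem le_tieProb {p q : ℝ} (hp : 0 ≤ p) (hq : 0 ≤ q) (hpq : p + q ≤ 1 / 4) (N : ℕ) :
    Real.exp (-(N * (√p - √q) ^ 2 + 6 * (N * (p + q) ^ 2))) / (4 * (2 * (N * (p + q)) + 1)) ≤
      tieProb p q N := by
  have h1 := exp_le_affinity hp hq hpq
  have hs := Real.sqrt_nonneg (p * q)
  have ht : 0 < √((1 - p) * (1 - q)) :=
    Real.sqrt_pos.2 (mul_pos (by linarith) (by linarith))
  have h3 : (√p - √q) ^ 2 = p + q - 2 * √(p * q) := by
    rw [Real.sqrt_mul hp, sub_sq, Real.sq_sqrt hp, Real.sq_sqrt hq]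
    ring
  have h4 : 2 * √(p * q) ≤ p + q := by linarith [sq_nonneg (√p - √q)]
  have hhalf : 1 / 2 ≤ √(p * q) + √((1 - p) * (1 - q)) := by
    have := Real.add_one_le_exp (-((√p - √q) ^ 2 / 2 + 3 * (p + q) ^ 2))
    nlinarith
  have hN : (0 : ℝ) ≤ N := Nat.cast_nonneg N
  have hNs : 0 ≤ N * √(p * q) := mul_nonneg hN hs
  have hJ1 := Nat.lt_floor_add_one (4 * (N * √(p * q)))
  have hJ2 := Nat.floor_le (show 0 ≤ 4 * (N * √(p * q)) by linarith)
  have h5 := le_sum_sq_binomial hs ht (N := N) (J := ⌊4 * (N * √(p * q))⌋₊) (by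
    have := mul_le_mul hJ1.le hhalf (by norm_num) (by positivity)
    linarith)
  refine le_trans ?_ h5
  refine div_le_div₀ (by positivity) ?_ (by positivity) ?_
  · have h6 := pow_le_pow_left₀ (pow_nonneg (Real.exp_pos _).le N)
      (pow_le_pow_left₀ (Real.exp_pos _).le h1 N) 2
    refine le_trans (le_of_eq ?_) h6
    rw [← Real.exp_nat_mul, ← Real.exp_nat_mul]
    congr 1
    push_cast
    ring
  · have := mul_le_mul_of_nonneg_left h4 hN
    linarith

end TieProbability

/-! ### Many labelings with the same likelihood -/

section Ambiguity

variable {n k : ℕ} {p q : ℝ}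

open scoped Classical in
/-- With high probability many balanced labelings have the same likelihood as the true one. -/
theorem sum_likelihood_few_ties_le (hk : 2 ≤ k) {m : ℕ} (hn : n = 2 * m) (hp0 : 0 ≤ p)
    (hp1 : p ≤ 1) (hq0 : 0 ≤ q) (hq1 : q ≤ 1) {w : ℕ} (hw : w ≤ m) {K : ℕ} (hK : 0 < K) {η : ℝ}
    (hη : 2 * w * ((n - 2).choose (k - 2) : ℝ) * (p + q) ≤ η)
    (hE : 4 * K ≤ w * tieProb p q ((m - w).choose (k - 1)))
    {σ : Labeling n} (hσ : Balanced σ) :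
    ∑ H : Hypergraph n k,
      (if ((balanced n).filter fun x => likelihood p q x H = likelihood p q σ H).card < K
        then likelihood p q σ H else 0) ≤
      2 * (4 / (w * tieProb p q ((m - w).choose (k - 1))) + 4 * η) := by
  set N := (m - w).choose (k - 1)
  set π := tieProb p q N with hπ
  have hKr : (0 : ℝ) < K := by exact_mod_cast hK
  have hπ0 : 0 ≤ π := Finset.sum_nonneg fun _ _ => sq_nonneg _
  have hr0 := edgeProb_nonneg (k := k) hp0 hq0 σ
  have hr1 := edgeProb_le (k := k) hp1 hq1 σ
  have hcl : ∀ s, (cluster σ s).card = m := fun s => by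
    have := hσ.two_mul_card_cluster s
    omega
  -- Reserve `w` vertices in each cluster.
  have hW : ∀ s : ℤˣ, ∃ W ⊆ cluster σ s, W.card = w := fun s =>
    Finset.exists_subset_card_eq (by rw [hcl s]; exact hw)
  choose W hWsub hWcard using hW
  set U := W 1 ∪ W (-1) with hU
  have hWU : ∀ s, W s ⊆ U := fun s => by
    rcases Int.units_eq_one_or s with rfl | rfl
    · exact Finset.subset_union_left
    · exact Finset.subset_union_right
  have hUcard : U.card ≤ 2 * w := by
    have := Finset.card_union_le (W 1) (W (-1))
    rw [hWcard, hWcard, ← hU] at this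
    omega
  have hrest : ∀ s, (cluster σ s \ U).card = m - w := fun s => by
    have : cluster σ s \ U = cluster σ s \ W s := by
      ext v
      simp only [Finset.mem_sdiff, mem_cluster]
      refine and_congr_right fun hv => not_congr ⟨fun hvU => ?_, fun h => hWU s h⟩
      have : ∀ s', v ∈ W s' → v ∈ W s := fun s' h => by
        rwa [← hv, mem_cluster.1 (hWsub s' h)]
      rcases Finset.mem_union.1 hvU with h | h <;> exact this _ h
    rw [this, Finset.card_sdiff_of_subset (hWsub s), hcl, hWcard]
  let A : Fin n → Finset (KSubset n k) := fun u => star k u (cluster σ (σ u) \ U)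
  let B : Fin n → Finset (KSubset n k) := fun u => star k u (cluster σ (-σ u) \ U)
  let C : Fin n → Finset (KSubset n k) := fun u => touching k u U
  let f : Fin n → Hypergraph n k → ℝ := fun u H => if (H ∩ A u).card = (H ∩ B u).card then 1 else 0
  let g : Fin n → Hypergraph n k → ℝ := fun u H => if (H ∩ C u).Nonempty then 1 else 0
  have hAB : ∀ u, Disjoint (A u) (B u) := fun u => by
    refine Finset.disjoint_left.2 fun e h1 h2 => ?_
    obtain ⟨v, hv, hvu⟩ := exists_ne_of_mem hk e u
    have h3 := (mem_star.1 h1).2 v hv hvu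
    have h4 := (mem_star.1 h2).2 v hv hvu
    rw [Finset.mem_sdiff, mem_cluster] at h3 h4
    exact units_ne_neg_self (σ u) (h3.1.symm.trans h4.1)
  have hout : ∀ u, ∀ e ∈ A u ∪ B u, u ∈ e.1 ∧ ∀ v ∈ e.1, v ≠ u → v ∉ U := by
    intro u e he
    rcases Finset.mem_union.1 he with h | h <;>
      exact ⟨(mem_star.1 h).1, fun v hv hvu => (Finset.mem_sdiff.1 ((mem_star.1 h).2 v hv hvu)).2⟩
  have hTT : ∀ u ∈ U, ∀ v ∈ U, u ≠ v → Disjoint (A u ∪ B u) (A v ∪ B v) :=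
    fun u _ v hv huv => Finset.disjoint_left.2 fun e h1 h2 =>
      (hout u e h1).2 v (hout v e h2).1 huv.symm hv
  have hTC : ∀ u, Disjoint (A u ∪ B u) (C u) := fun u =>
    Finset.disjoint_left.2 fun e h1 h2 => by
      obtain ⟨-, v, hv, hvu, hvU⟩ := mem_touching.1 h2
      exact (hout u e h1).2 v hv hvu hvU
  have hfT : ∀ u H, f u (H ∩ (A u ∪ B u)) = f u H := fun u H => by
    simp only [f]
    rw [Finset.inter_assoc, Finset.inter_assoc,
      Finset.inter_eq_right.2 (Finset.subset_union_left (s₁ := A u) (s₂ := B u)),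
      Finset.inter_eq_right.2 (Finset.subset_union_right (s₁ := A u) (s₂ := B u))]
  have hgC : ∀ u H, g u (H ∩ C u) = g u H := fun u H => by
    simp only [g]
    rw [Finset.inter_assoc, Finset.inter_self]
  have hstar : ∀ u ∈ U, ∀ s, (star k u (cluster σ s \ U)).card = N := fun u hu s => by
    rw [card_star (by omega) fun h => (Finset.mem_sdiff.1 h).2 hu, hrest]
  have hmean : ∀ u ∈ U, expect (edgeProb p q σ) (f u) = π := by
    intro u hu
    refine expect_card_inter_eq_card_inter (hAB u) (p := p) (q := q) ?_ ?_ (hstar u hu _)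
      (hstar u hu _) (mul_nonneg hp0 hq0) (mul_nonneg (by linarith) (by linarith))
    · intro e he
      have hall : ∀ v ∈ e.1, σ v = σ u := fun v hv => by
        by_cases h : v = u
        · rw [h]
        · exact mem_cluster.1 (Finset.mem_sdiff.1 ((mem_star.1 he).2 v hv h)).1
      exact if_pos fun a ha b hb => (hall a ha).trans (hall b hb).symm
    · intro e he
      obtain ⟨v, hv, hvu⟩ := exists_ne_of_mem hk e u
      have h1 := mem_cluster.1 (Finset.mem_sdiff.1 ((mem_star.1 he).2 v hv hvu)).1
      exact if_neg fun h => units_ne_neg_self (σ u) ((h u (mem_star.1 he).1 v hv).trans h1)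
  have hpair : ∀ u ∈ U, ∀ v ∈ U, u ≠ v →
      expect (edgeProb p q σ) (fun H => f u H * f v H) = π * π := by
    intro u hu v hv huv
    have := expect_mul_of_disjoint (edgeProb p q σ) (hTT u hu v hv huv) (f u) (f v)
    simp only [hfT] at this
    rw [this]
    exact congrArg₂ _ (hmean u hu) (hmean v hv)
  have hfg : ∀ u ∈ U, expect (edgeProb p q σ) (fun H => f u H * g u H) ≤ η * π := by
    intro u hu
    have := expect_mul_of_disjoint (edgeProb p q σ) (hTC u) (f u) (g u)
    simp only [hfT, hgC] at this
    rw [this, mul_comm]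
    have hm : expect (edgeProb p q σ) (fun H => f u H) = π := hmean u hu
    rw [hm]
    refine mul_le_mul_of_nonneg_right ?_ hπ0
    refine (expect_nonempty_inter_le hr0 hr1 (c := p + q) fun e _ =>
      edgeProb_le (by linarith) (by linarith) σ e).trans (le_trans ?_ hη)
    refine mul_le_mul_of_nonneg_right ?_ (by linarith)
    have h1 := (card_touching_le hk u U).trans (Nat.mul_le_mul_right _ hUcard)
    exact_mod_cast h1
  have hbound : ∀ s, expect (edgeProb p q σ) (fun H =>
      if ∑ u ∈ W s, f u H * (1 - g u H) < w * π / 4 then 1 else 0) ≤ 4 / (w * π) + 4 * η := by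
    intro s
    have := expect_sum_lt_le hr0 hr1 (W := W s) (f := f) (g := g) (π := π) (η := η)
      (B := fun H => ∑ u ∈ W s, f u H * (1 - g u H) < w * π / 4)
      (fun u _ H => by simp only [f]; split_ifs <;> simp)
      (fun u _ H => by simp only [g]; split_ifs <;> simp)
      (by rw [hWcard]; linarith)
      (fun u hu => hmean u (hWU s hu)) (fun u hu v hv => hpair u (hWU s hu) v (hWU s hv))
      (fun u hu => hfg u (hWU s hu)) (fun H hH => by rw [hWcard]; exact hH)
    rwa [hWcard] at this
  -- A vertex is good if it is tied and shares no hyperedge with another reserved vertex.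
  -- With at least `K` good vertices on either side, there are `K` exchanges.
  have hgood : ∀ s H, ∑ u ∈ W s, f u H * (1 - g u H) =
      ((W s).filter fun u => (H ∩ A u).card = (H ∩ B u).card ∧ H ∩ C u = ∅).card := by
    intro s H
    rw [Finset.card_filter]
    push_cast
    refine Finset.sum_congr rfl fun u _ => ?_
    simp only [f, g, Finset.nonempty_iff_ne_empty]
    by_cases h1 : (H ∩ A u).card = (H ∩ B u).card <;> by_cases h2 : H ∩ C u = ∅ <;> simp [h1, h2]
  have hevent : ∀ H : Hypergraph n k,
      ((balanced n).filter fun x => likelihood p q x H = likelihood p q σ H).card < K →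
      ∑ u ∈ W 1, f u H * (1 - g u H) < w * π / 4 ∨
        ∑ u ∈ W (-1), f u H * (1 - g u H) < w * π / 4 := by
    intro H hH
    by_contra hcon
    rw [not_or, not_lt, not_lt, hgood, hgood] at hcon
    have h1 : K ≤ ((W 1).filter fun u => (H ∩ A u).card = (H ∩ B u).card ∧ H ∩ C u = ∅).card := by
      have : (K : ℝ) ≤ w * π / 4 := by linarith
      exact_mod_cast this.trans hcon.1
    have h2 : 0 < ((W (-1)).filter fun u =>
        (H ∩ A u).card = (H ∩ B u).card ∧ H ∩ C u = ∅).card := by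
      have : (0 : ℝ) < w * π / 4 := by linarith
      exact_mod_cast this.trans_le hcon.2
    obtain ⟨v, hv⟩ := Finset.card_pos.1 h2
    obtain ⟨hvW, htv, hcv⟩ := Finset.mem_filter.1 hv
    have hσv : σ v = -1 := mem_cluster.1 (hWsub _ hvW)
    refine absurd hH (not_lt.2 (h1.trans ?_))
    refine Finset.card_le_card_of_injOn (fun u => swapLabels σ u v) ?_ ?_
    · intro u hu
      obtain ⟨huW, htu, hcu⟩ := Finset.mem_filter.1 hu
      have hσu : σ u = 1 := mem_cluster.1 (hWsub _ huW)
      refine Finset.mem_filter.2 ⟨mem_balanced.2 (hσ.swapLabels u v), ?_⟩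
      exact likelihood_swapLabels hk (hWU _ huW) (hWU _ hvW) (by rw [hσu, hσv]; decide) hcu hcv
        htu htv
    · refine swapLabels_injOn.mono fun u hu => ?_
      have hσu : σ u = 1 := mem_cluster.1 (hWsub _ (Finset.mem_filter.1 hu).1)
      show σ u ≠ σ v
      rw [hσu, hσv]
      decide
  calc _ ≤ expect (edgeProb p q σ) (fun H =>
        (if ∑ u ∈ W 1, f u H * (1 - g u H) < w * π / 4 then 1 else 0) +
          (if ∑ u ∈ W (-1), f u H * (1 - g u H) < w * π / 4 then 1 else 0)) := by
        refine Finset.sum_le_sum fun H _ => ?_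
        have hL := bernWeight_nonneg hr0 hr1 Finset.univ H
        have hite : ∀ P : Prop, [Decidable P] → (0 : ℝ) ≤ if P then 1 else 0 :=
          fun P _ => by positivity
        split_ifs with h
        · rw [likelihood_eq_bernWeight]
          refine le_mul_of_one_le_right hL ?_
          beta_reduce
          rcases hevent H h with h1 | h1 <;> rw [if_pos h1]
          · exact le_add_of_nonneg_right (hite _)
          · exact le_add_of_nonneg_left (hite _)
        · exact mul_nonneg hL (add_nonneg (hite _) (hite _))
    _ ≤ _ := by
        rw [expect_add]
        linarith [hbound 1, hbound (-1)]

end Ambiguity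

/-! ### Impossibility below the threshold -/

section Impossibility

variable {k : ℕ} {α β : ℝ}

theorem failProb_le_one {n : ℕ} {p q : ℝ} (hp0 : 0 ≤ p) (hp1 : p ≤ 1) (hq0 : 0 ≤ q) (hq1 : q ≤ 1)
    (τ : Estimator n k) : failProb p q τ ≤ 1 := by
  classical
  refine prob_le_of_forall zero_le_one fun σ _ => ?_
  rw [← sum_likelihood (k := k) p q σ]
  refine Finset.sum_le_sum fun H _ => ?_
  have := likelihood_nonneg hp0 hp1 hq0 hq1 σ H
  split_ifs
  · exact this
  · exact le_rfl

/-- Up to logarithmic factors, a reserved vertex has a tie with probability at least `n ^ (-I)`. -/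
theorem le_tieProb_rate (hk : 2 ≤ k) (hα : 0 ≤ α) (hβ : 0 ≤ β) {m w : ℕ} (hw : 1 ≤ w)
    (hn : 2 * k ≤ 2 * m) (hpq : rate k α (2 * m) + rate k β (2 * m) ≤ 1 / 4)
    (hsmall : 12 * (α + β) ^ 2 * (Real.log (2 * m : ℕ) ^ 2 / (2 * m : ℕ)) ≤ 1) :
    Real.exp (-(threshold k α β * Real.log (2 * m : ℕ) + 1)) /
        (4 * (2 * ((α + β) * Real.log (2 * m : ℕ)) + 1)) ≤
      tieProb (rate k α (2 * m)) (rate k β (2 * m)) ((m - w).choose (k - 1)) := by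
  set n := 2 * m with hnm
  set p := rate k α n
  set q := rate k β n
  set N := (m - w).choose (k - 1)
  set L := Real.log (n : ℕ)
  have hp : 0 ≤ p := rate_nonneg hα n
  have hq : 0 ≤ q := rate_nonneg hβ n
  have hL : 0 ≤ L := Real.log_natCast_nonneg n
  have hB : 2 ^ (k - 1) * N ≤ (n - 1).choose (k - 1) :=
    (two_pow_mul_choose_le _ _).trans (Nat.choose_le_choose _ (by omega))
  have hB' : 2 ^ (k - 1) * (N : ℝ) ≤ ((n - 1).choose (k - 1) : ℝ) := by exact_mod_cast hB
  have hNB : (N : ℝ) ≤ ((n - 1).choose (k - 1) : ℝ) := by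
    have : N ≤ (n - 1).choose (k - 1) := le_trans (Nat.le_mul_of_pos_left _ (by positivity)) hB
    exact_mod_cast this
  have h1 : N * (√p - √q) ^ 2 ≤ threshold k α β * L := by
    have h2 : (0 : ℝ) < 2 ^ (k - 1) := by positivity
    refine le_of_mul_le_mul_left ?_ h2
    rw [← sq_sub_sqrt_rate hα hβ (show k ≤ n by omega)]
    have := mul_le_mul_of_nonneg_right hB' (sq_nonneg (√p - √q))
    linarith
  have h2 : N * (p + q) ≤ (α + β) * L := by
    have h3 : p * ((n - 1).choose (k - 1) : ℝ) = α * L := rate_mul_choose (by omega)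
    have h4 : q * ((n - 1).choose (k - 1) : ℝ) = β * L := rate_mul_choose (by omega)
    have := mul_le_mul_of_nonneg_right hNB (add_nonneg hp hq)
    linarith
  have h3 : p + q ≤ 2 * (α + β) * (L / n) := by
    have h4 : p ≤ _ := rate_le hk hα hn
    have h5 : q ≤ _ := rate_le hk hβ hn
    linarith
  have h4 : 6 * (N * (p + q) ^ 2) ≤ 1 := by
    have := mul_le_mul h2 h3 (add_nonneg hp hq) (by positivity)
    calc 6 * (N * (p + q) ^ 2) = 6 * (N * (p + q) * (p + q)) := by ring
      _ ≤ 6 * ((α + β) * L * (2 * (α + β) * (L / n))) := by linarith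
      _ = 12 * (α + β) ^ 2 * (L ^ 2 / n) := by ring
      _ ≤ 1 := hsmall
  refine le_trans ?_ (le_tieProb hp hq hpq N)
  refine div_le_div₀ (Real.exp_pos _).le (Real.exp_le_exp.2 (by linarith)) (by positivity)
    (by linarith)

theorem choose_mul_rate_le (hk : 2 ≤ k) (hα : 0 ≤ α) (hβ : 0 ≤ β) {n : ℕ} (hn : 2 * k ≤ n) :
    ((n - 2).choose (k - 2) : ℝ) * (rate k α n + rate k β n) ≤
      2 * ((k - 1 : ℕ) : ℝ) * ((α + β) * Real.log n) / n := by
  have h1 : ((n - 1 : ℕ) : ℝ) * ((n - 2).choose (k - 2) : ℝ) =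
      ((n - 1).choose (k - 1) : ℝ) * ((k - 1 : ℕ) : ℝ) := by
    have h := Nat.add_one_mul_choose_eq (n - 2) (k - 2)
    rw [show n - 2 + 1 = n - 1 by omega, show k - 2 + 1 = k - 1 by omega] at h
    exact_mod_cast h
  have h2 : rate k α n * ((n - 1).choose (k - 1) : ℝ) = α * Real.log n :=
    rate_mul_choose (by omega)
  have h3 : rate k β n * ((n - 1).choose (k - 1) : ℝ) = β * Real.log n :=
    rate_mul_choose (by omega)
  have h4 : ((n - 1 : ℕ) : ℝ) * (((n - 2).choose (k - 2) : ℝ) * (rate k α n + rate k β n)) =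
      ((k - 1 : ℕ) : ℝ) * ((α + β) * Real.log n) := by
    linear_combination (rate k α n + rate k β n) * h1 + ((k - 1 : ℕ) : ℝ) * (h2 + h3)
  have h5 : (n : ℝ) ≤ 2 * ((n - 1 : ℕ) : ℝ) := by
    exact_mod_cast (by omega : n ≤ 2 * (n - 1))
  have hn0 : (0 : ℝ) < n := by exact_mod_cast (by omega : 0 < n)
  rw [le_div_iff₀ hn0]
  have hp := rate_nonneg (k := k) hα n
  have hq := rate_nonneg (k := k) hβ n
  have := mul_le_mul_of_nonneg_right h5
    (show 0 ≤ ((n - 2).choose (k - 2) : ℝ) * (rate k α n + rate k β n) by positivity)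
  linarith

/-- The impossibility bound for one `n`, with `x * y = n` and about `x` reserved vertices in each
cluster: the expected number of ties is of order at least `y / log n`, and a reserved vertex
shares a hyperedge with another one with probability of order at most `log n / y`. -/
theorem le_failProb_rate (hk : 2 ≤ k) (hα : 0 < α) (hβ : 0 < β) {n : ℕ} (heven : Even n)
    (hnk : 2 * k ≤ n) (hpq : rate k α n + rate k β n ≤ 1 / 4)
    (hsmall : 12 * (α + β) ^ 2 * (Real.log n ^ 2 / n) ≤ 1) {x y : ℝ} (hx : 2 ≤ x) (hy : 2 ≤ y)
    (hxy : x * y = n) (hxI : x * Real.exp (-(threshold k α β * Real.log n)) = y) {K : ℕ}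
    (hK : 0 < K) {a η : ℝ}
    (ha : a = 8 * Real.exp 1 * (2 * ((α + β) * Real.log n) + 1) / y)
    (hη : η = 4 * ((k - 1 : ℕ) : ℝ) * ((α + β) * Real.log n) / y)
    (haK : a ≤ 1 / (4 * K)) (τ : Estimator n k) :
    1 - (2 / K + 2 * (4 * a + 4 * η)) ≤ failProb (rate k α n) (rate k β n) τ := by
  obtain ⟨m, rfl⟩ : ∃ m, n = 2 * m := heven.two_dvd
  have hKr : (0 : ℝ) < K := by exact_mod_cast hK
  have hp0 : 0 ≤ rate k α (2 * m) := rate_nonneg hα.le _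
  have hq0 : 0 ≤ rate k β (2 * m) := rate_nonneg hβ.le _
  have hL0 : 0 ≤ Real.log (2 * m : ℕ) := Real.log_natCast_nonneg _
  have hx0 : 0 < x := by linarith
  have hy0 : 0 < y := by linarith
  have hwx : (⌊x⌋₊ : ℝ) ≤ x := Nat.floor_le hx0.le
  have hxw : x / 2 ≤ ⌊x⌋₊ := by
    have := Nat.lt_floor_add_one x
    linarith
  generalize ⌊x⌋₊ = w at hwx hxw
  have hw1 : 1 ≤ w := by
    have : (1 : ℝ) ≤ w := by linarith
    exact_mod_cast this
  have hwm : w ≤ m := by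
    have h1 : 2 * (w : ℝ) ≤ (2 * m : ℕ) := by nlinarith
    have h2 : 2 * w ≤ 2 * m := by exact_mod_cast h1
    omega
  have hT := le_tieProb_rate hk hα.le hβ.le hw1 hnk hpq hsmall
  have hηn : 2 * w * ((2 * m - 2).choose (k - 2) : ℝ) * (rate k α (2 * m) + rate k β (2 * m)) ≤
      η := by
    have h6 : 2 * w * ((2 * m - 2).choose (k - 2) : ℝ) * (rate k α (2 * m) + rate k β (2 * m)) ≤
        2 * x * (2 * ((k - 1 : ℕ) : ℝ) * ((α + β) * Real.log (2 * m : ℕ)) / (2 * m : ℕ)) := by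
      rw [mul_assoc]
      exact mul_le_mul (by linarith) (choose_mul_rate_le hk hα.le hβ.le hnk) (by positivity)
        (by positivity)
    refine h6.trans (le_of_eq ?_)
    rw [hη, ← hxy]
    field_simp
    ring
  have hmain := fun hK4 σ hσ => sum_likelihood_few_ties_le (σ := σ) hk rfl hp0 (by linarith) hq0
    (by linarith) hwm hK hηn hK4 hσ
  generalize tieProb (rate k α (2 * m)) (rate k β (2 * m)) ((m - w).choose (k - 1)) = π
    at hT hmain
  have ha_pos : 0 < a := by rw [ha]; positivity
  have hE : 1 / a ≤ w * π := by
    have h1 : 1 / a = x / 2 * (Real.exp (-(threshold k α β * Real.log (2 * m : ℕ) + 1)) /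
        (4 * (2 * ((α + β) * Real.log (2 * m : ℕ)) + 1))) := by
      rw [ha, ← hxI, neg_add, ← sub_eq_add_neg, Real.exp_sub]
      field_simp
      norm_num
    rw [h1]
    exact mul_le_mul hxw hT (by positivity) (Nat.cast_nonneg w)
  have hEpos : 0 < w * π := lt_of_lt_of_le (by positivity) hE
  have hK4 : 4 * (K : ℝ) ≤ w * π := by
    refine le_trans ?_ hE
    rw [le_div_iff₀ ha_pos]
    rw [le_div_iff₀ (by positivity)] at haK
    linarith
  refine le_trans ?_ (one_sub_le_failProb heven hp0 (by linarith) hq0 (by linarith) hK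
    (hmain hK4) τ)
  have h9 : 4 / (w * π) ≤ 4 * a := by
    rw [div_le_iff₀ hEpos]
    rw [div_le_iff₀ ha_pos] at hE
    linarith
  linarith

/-- Every estimator fails with probability at least `1 - 2 / K - o(1)`, for every `K`. -/
theorem eventually_le_failProb (hk : 2 ≤ k) (hα : 0 < α) (hβ : 0 < β)
    (hI : threshold k α β < 1) :
    ∃ c : ℕ → ℝ, Tendsto c atTop (𝓝 0) ∧ ∀ K : ℕ, 0 < K → ∀ᶠ n : ℕ in evenAtTop,
      ∀ τ : Estimator n k, 1 - (2 / K + c n) ≤ failProb (rate k α n) (rate k β n) τ := by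
  have hI0 : 0 ≤ threshold k α β := by unfold threshold; positivity
  -- About `n ^ (1 - γ)` vertices are reserved, where `1 - γ - I = γ`.
  obtain ⟨γ, hγ⟩ : ∃ γ, γ = (1 - threshold k α β) / 2 := ⟨_, rfl⟩
  have hγ0 : 0 < γ := by linarith
  have hγ1 : 0 < 1 - γ := by linarith
  have hlog : Tendsto (fun n : ℕ => Real.log n / (n : ℝ) ^ γ) atTop (𝓝 0) := by
    simpa using tendsto_log_pow_div 1 hγ0
  have hone : Tendsto (fun n : ℕ => 1 / (n : ℝ) ^ γ) atTop (𝓝 0) := by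
    simpa using tendsto_log_pow_div 0 hγ0
  have ha0 : Tendsto (fun n : ℕ =>
      8 * Real.exp 1 * (2 * ((α + β) * Real.log n) + 1) / (n : ℝ) ^ γ) atTop (𝓝 0) := by
    have := ((hlog.const_mul (2 * (α + β))).add hone).const_mul (8 * Real.exp 1)
    rw [mul_zero, add_zero, mul_zero] at this
    exact this.congr fun n => by ring
  have hη0 : Tendsto (fun n : ℕ =>
      4 * ((k - 1 : ℕ) : ℝ) * ((α + β) * Real.log n) / (n : ℝ) ^ γ) atTop (𝓝 0) := by
    have := hlog.const_mul (4 * ((k - 1 : ℕ) : ℝ) * (α + β))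
    rw [mul_zero] at this
    exact this.congr fun n => by ring
  have hc := ((ha0.const_mul 4).add (hη0.const_mul 4)).const_mul 2
  rw [mul_zero, add_zero, mul_zero] at hc
  refine ⟨_, hc, fun K hK => ?_⟩
  have hKr : (0 : ℝ) < K := by exact_mod_cast hK
  have hpq0 : Tendsto (fun n => rate k α n + rate k β n) atTop (𝓝 0) := by
    simpa using (tendsto_rate hk hα.le).add (tendsto_rate hk hβ.le)
  have hsq : Tendsto (fun n : ℕ => 12 * (α + β) ^ 2 * (Real.log n ^ 2 / n)) atTop (𝓝 0) := by
    simpa using (tendsto_log_pow_div 2 one_pos).const_mul (12 * (α + β) ^ 2)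
  have hpow : ∀ b : ℝ, 0 < b → Tendsto (fun n : ℕ => (n : ℝ) ^ b) atTop atTop := fun b hb =>
    (tendsto_rpow_atTop hb).comp tendsto_natCast_atTop_atTop
  rw [evenAtTop, eventually_inf_principal]
  filter_upwards [hpq0.eventually_le_const (show (0 : ℝ) < 1 / 4 by norm_num),
    hsq.eventually_le_const one_pos, (hpow _ hγ1).eventually_ge_atTop 2,
    (hpow _ hγ0).eventually_ge_atTop 2, eventually_ge_atTop (2 * k),
    ha0.eventually_le_const (show (0 : ℝ) < 1 / (4 * K) by positivity)]
    with n hpq hsmall hx hy hnk haK heven τ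
  have hn0 : (0 : ℝ) < n := by exact_mod_cast (by omega : 0 < n)
  refine le_failProb_rate hk hα hβ heven hnk hpq hsmall hx hy ?_ ?_ hK rfl rfl haK τ
  · rw [← Real.rpow_add hn0]
    simp
  · have : Real.exp (-(threshold k α β * Real.log n)) = (n : ℝ) ^ (-threshold k α β) := by
      rw [Real.rpow_def_of_pos hn0, mul_neg, mul_comm]
    rw [this, ← Real.rpow_add hn0]
    congr 1
    linarith

theorem exactRecoveryImpossible (hk : 2 ≤ k) (hα : 0 < α) (hβ : 0 < β)
    (hI : threshold k α β < 1) : ExactRecoveryImpossible k (rate k α) (rate k β) := by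
  intro τ
  obtain ⟨c, hc, h⟩ := eventually_le_failProb hk hα hβ hI
  have hle : evenAtTop ≤ atTop := inf_le_left
  refine tendsto_order.2 ⟨fun b hb => ?_, fun b hb => ?_⟩
  · obtain ⟨K, hK⟩ := exists_nat_gt (4 / (1 - b))
    have hb' : 0 < 1 - b := by linarith
    have hK0 : (0 : ℝ) < K := lt_trans (by positivity) hK
    have hK2 : 2 / (K : ℝ) < (1 - b) / 2 := by
      rw [div_lt_iff₀ hb'] at hK
      rw [div_lt_iff₀ hK0]
      linarith
    filter_upwards [h K (by exact_mod_cast hK0),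
      hle (hc.eventually_lt_const (show 0 < (1 - b) / 2 by linarith))] with n h1 h2
    have := h1 (τ n)
    linarith
  · filter_upwards [hle ((tendsto_rate hk hα.le).eventually_le_const one_pos),
      hle ((tendsto_rate hk hβ.le).eventually_le_const one_pos)] with n hp hq
    exact (failProb_le_one (rate_nonneg hα.le _) hp (rate_nonneg hβ.le _) hq _).trans_lt hb

end Impossibility

end HSBM

theorem theorem1 (k : ℕ) (hk : 2 ≤ k) (α β : ℝ) (hα : 0 < α) (hβ : 0 < β) :
    (1 < HSBM.threshold k α β →
      HSBM.ExactRecoveryPossible k (HSBM.rate k α) (HSBM.rate k β) ∧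
      ∀ τ : ∀ n : ℕ, HSBM.Estimator n k,
        (∀ n : ℕ, Even n → HSBM.IsMLE (HSBM.rate k α n) (HSBM.rate k β n) (τ n)) →
        ∃ ε : ℕ → ℝ, Tendsto ε HSBM.evenAtTop (𝓝 0) ∧
          ∀ᶠ n : ℕ in HSBM.evenAtTop,
            HSBM.failProb (HSBM.rate k α n) (HSBM.rate k β n) (τ n) ≤
              (n : ℝ) ^ (-(HSBM.threshold k α β - 1) / 2 + ε n)) ∧
    (HSBM.threshold k α β < 1 →
      HSBM.ExactRecoveryImpossible k (HSBM.rate k α) (HSBM.rate k β)) := by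
  refine ⟨fun hI => ⟨HSBM.exactRecoveryPossible hk hα hβ hI, fun τ hτ => ?_⟩,
    fun hI => HSBM.exactRecoveryImpossible hk hα hβ hI⟩
  -- The union bound already holds with the exponent `-(I - 1) / 2`.
  refine ⟨fun _ => 0, tendsto_const_nhds, ?_⟩
  have heven : ∀ᶠ n : ℕ in HSBM.evenAtTop, Even n := by
    rw [HSBM.evenAtTop, eventually_inf_principal]
    exact Eventually.of_forall fun n hn => hn
  filter_upwards [HSBM.eventually_failProb_le hk hα hβ hI, heven] with n h hn
  rw [add_zero, neg_div]
  exact h (τ n) (hτ n hn)
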